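/- Let $M$ be a closed smooth $m$-manifold, $(N,\gamma)$ a closed Riemannian manifold, $\kappa\ge 0$, $0<T\le\infty$, and let $(g(t),\varphi(t))$, $t\in[0,T)$, be a smooth solution on $M$ of the Ricci flow coupled with the harmonic map flow, $$\partial_t g=-2\,\mathrm{Ric}_{g}+2\kappa\,\nabla\varphi\otimes\nabla\varphi,\qquad \partial_t\varphi=\tau_{g}\varphi ,$$ where $\nabla\varphi\otimes\nabla\varphi=\varphi^*\gamma$ and $\tau_g\varphi$ is the tension field of $\varphi:M\to N$. Put $\mathcal S=\mathrm{Ric}_g-\kappa\nabla\varphi\otimes\nabla\varphi$ and $S=R-\kappa|\nabla\varphi|^2$. Let $p,q>1$ and $\alpha,\beta>0$ with $\frac{\alpha+1}{p}+\frac{\beta+1}{q}=1$, and let $$G(g,u,v)=\frac{\alpha+1}{p}\int_M|\nabla u|_g^p\,d\mu_g+\frac{\beta+1}{q}\int_M|\nabla v|_g^q\,d\mu_g,\qquad B(g,u,v)=\int_M|u|^\alpha|v|^\beta uv\,d\mu_g .$$ Call $(u,v)\in W^{1,p}(M)\times W^{1,q}(M)$ admissible at time $t$ if $B(g(t),u,v)=1$;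 in a second version also require $\int_M|u|^\alpha|v|^\beta v\,d\mu_{g(t)}=\int_M|u|^\alpha|v|^\beta u\,d\mu_{g(t)}=0$ (conditions that hold for all eigenfunctions with nonzero eigenvalue). In either version let $\lambda(t)$, the first eigenvalue of the $(p,q)$-Laplacian, be the infimum of $G(g(t),u,v)$ over all pairs $(u,v)$ admissible at time $t$. The following holds for both versions. Let $0\le t_0<t_1<T$, and let $(u_1,v_1)$ be an admissible pair of eigenfunctions for $\lambda(t_1)$ at time $t_1$; that is, an admissible pair that is a weak solution of $$\Delta_pu=-\lambda(t_1)|u|^\alpha|v|^\beta v,\qquad \Delta_qv=-\lambda(t_1)|u|^\alpha|v|^\beta u$$ with respect to $g(t_1)$, or that realizes the infimum $\lambda(t_1)$. Put $$h(t)=u_1\Big[\tfrac{\det g_{ij}(t_1)}{\det g_{ij}(t)}\Big]^{\frac1{2(\alpha+\beta+1)}},\qquad l(t)=v_1\Big[\tfrac{\det g_{ij}(t_1)}{\det g_{ij}(t)}\Big]^{\frac1{2(\alpha+\beta+1)}},\qquad n(t)=\int_M|h|^\alpha|l|^\beta hl\,d\mu_{g(t)},$$ suppose that $n(t)>0$ for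 $t\in[t_0,t_1]$, and put $u(t)=h(t)\,n(t)^{-1/p}$, $v(t)=l(t)\,n(t)^{-1/q}$. Write $'$ for the time derivative on $[0,T)$. Then for $t\in[t_0,t_1]$ the pair $(u(t),v(t))$ is admissible at time $t$, $u$ and $v$ are smooth in $t$ at each point of $M$, $u'(t)\in W^{1,p}(M)$ and $v'(t)\in W^{1,q}(M)$; moreover $(u(t_1),v(t_1))=(u_1,v_1)$ and $G(g(t_1),u(t_1),v(t_1))=\lambda(t_1)$. On $[t_0,t_1]$ the function $t\mapsto G(g(t),u(t),v(t))$ is differentiable with derivative $$\begin{aligned}\mathcal G(t)={}&(\alpha+1)\int_M\big(\mathcal S(\nabla u,\nabla u)+\langle\nabla u',\nabla u\rangle\big)|\nabla u|^{p-2}d\mu+(\beta+1)\int_M\big(\mathcal S(\nabla v,\nabla v)+\langle\nabla v',\nabla v\rangle\big)|\nabla v|^{q-2}d\mu\\&-\frac{\alpha+1}{p}\int_M|\nabla u|^pS\,d\mu-\frac{\beta+1}{q}\int_M|\nabla v|^qS\,d\mu,\end{aligned}$$ (integrands are $0$ where the gradient in question vanishes), $\mathcal G$ is integrable on $[t_0,t_1]$,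 and $$\lambda(t_1)\ \ge\ \lambda(t_0)+\int_{t_0}^{t_1}\mathcal G(\tau)\,d\tau .$$ -/

import Mathlib

open scoped Manifold ContDiff
open MeasureTheory

noncomputable section

namespace RHFlow

/-- The model space `ℝᵐ`. -/
abbrev Euc (m : ℕ) : Type := EuclideanSpace ℝ (Fin m)

/-- The `i`-th vector of the standard basis of `ℝᵐ`. -/
abbrev stdVec (m : ℕ) (i : Fin m) : Euc m := EuclideanSpace.single i (1 : ℝ)

/-! ### Tensor calculus in coordinates

Here a metric is given by its matrix `G = (G_ij)`, a function on (an open subset of) `ℝᵐ`. -/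

/-- Partial derivative `∂ᵢ f`. -/
def partialD {m : ℕ} (i : Fin m) (f : Euc m → ℝ) (y : Euc m) : ℝ :=
  fderiv ℝ f y (stdVec m i)

/-- Christoffel symbol `Γᵏᵢⱼ = ½ Gᵏˡ (∂ᵢ Gⱼₗ + ∂ⱼ Gᵢₗ - ∂ₗ Gᵢⱼ)`. -/
def christoffel {m : ℕ} (G : Euc m → Matrix (Fin m) (Fin m) ℝ) (k i j : Fin m) (y : Euc m) : ℝ :=
  (1 / 2) * ∑ l, (G y)⁻¹ k l *
    (partialD i (fun z => G z j l) y + partialD j (fun z => G z i l) y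
      - partialD l (fun z => G z i j) y)

/-- Ricci tensor `Ricᵢⱼ = ∂ₖ Γᵏᵢⱼ - ∂ⱼ Γᵏᵢₖ + Γᵏₖₗ Γˡᵢⱼ - Γᵏⱼₗ Γˡᵢₖ`. -/
def ricciCoord {m : ℕ} (G : Euc m → Matrix (Fin m) (Fin m) ℝ) (i j : Fin m) (y : Euc m) : ℝ :=
  ∑ k, (partialD k (christoffel G k i j) y - partialD j (christoffel G k i k) y
    + ∑ l, (christoffel G k k l y * christoffel G l i j y
      - christoffel G k j l y * christoffel G l i k y))

theorem exists_chartCover (m : ℕ) (M : Type*) [TopologicalSpace M] [ChartedSpace (Euc m) M]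
    [CompactSpace M] : ∃ s : Finset M, ∀ x : M, ∃ c ∈ s, x ∈ (extChartAt (𝓡 m) c).source := by
  obtain ⟨s, -, hs⟩ := isCompact_univ.elim_nhds_subcover
    (fun c : M => (extChartAt (𝓡 m) c).source) (fun c _ => extChartAt_source_mem_nhds c)
  exact ⟨s, fun x => by simpa using hs (Set.mem_univ x)⟩

section Manifold

variable {m : ℕ} {M : Type*} [TopologicalSpace M] [ChartedSpace (Euc m) M]
  [IsManifold (𝓡 m) ∞ M]

/-- Smooth Riemannian metrics on a smooth `m`-manifold `M`. -/
abbrev Metric (m : ℕ) (M : Type*) [TopologicalSpace M] [ChartedSpace (Euc m) M]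
    [IsManifold (𝓡 m) ∞ M] :=
  Bundle.ContMDiffRiemannianMetric (𝓡 m) ∞ (Euc m) (fun x : M => TangentSpace (𝓡 m) x)

/-- The standard basis of `T_x M` (which in Mathlib is `ℝᵐ`). -/
def tangentVec (x : M) (i : Fin m) : TangentSpace (𝓡 m) x := stdVec m i

/-- The coordinate vector `∂ᵢ` of the chart at `c`, at the point with coordinates `y`. -/
def chartFrame (c : M) (y : Euc m) (i : Fin m) :
    TangentSpace (𝓡 m) ((extChartAt (𝓡 m) c).symm y) :=
  mfderiv 𝓘(ℝ, Euc m) (𝓡 m) (extChartAt (𝓡 m) c).symm y (stdVec m i)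

/-- The matrix `g_ij` of the metric in the chart at `c`. -/
def gramInChart (g : Metric m M) (c : M) (y : Euc m) : Matrix (Fin m) (Fin m) ℝ :=
  Matrix.of fun i j =>
    g.inner ((extChartAt (𝓡 m) c).symm y) (chartFrame c y i) (chartFrame c y j)

/-- The matrix `g_ij(x)` of the metric on `T_x M`. -/
def gram (g : Metric m M) (x : M) : Matrix (Fin m) (Fin m) ℝ :=
  Matrix.of fun i j => g.inner x (tangentVec x i) (tangentVec x j)

/-- The trace `gⁱʲ bᵢⱼ` of a bilinear form `b` on `T_x M`. -/
def metricTrace (g : Metric m M) (x : M)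
    (b : TangentSpace (𝓡 m) x → TangentSpace (𝓡 m) x → ℝ) : ℝ :=
  ∑ i, ∑ j, (gram g x)⁻¹ i j * b (tangentVec x i) (tangentVec x j)

/-- The vector `ξ♯ = gⁱʲ ξⱼ ∂ᵢ` metrically dual to a covector `ξ`. -/
def sharp (g : Metric m M) (x : M) (ξ : TangentSpace (𝓡 m) x →L[ℝ] ℝ) : TangentSpace (𝓡 m) x :=
  ∑ i, (∑ j, (gram g x)⁻¹ i j * ξ (tangentVec x j)) • tangentVec x i

/-- The Ricci tensor of `g` as a bilinear form on `T_x M`, computed in the chart at `x`. -/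
def ricci (g : Metric m M) (x : M) (v w : TangentSpace (𝓡 m) x) : ℝ :=
  let dv : Euc m := mfderiv (𝓡 m) 𝓘(ℝ, Euc m) (extChartAt (𝓡 m) x) x v
  let dw : Euc m := mfderiv (𝓡 m) 𝓘(ℝ, Euc m) (extChartAt (𝓡 m) x) x w
  ∑ i, ∑ j, ricciCoord (gramInChart g x) i j (extChartAt (𝓡 m) x x) * dv i * dw j

/-! ### Maps into a second Riemannian manifold and the flow -/

section Maps

variable {n : ℕ} {N : Type*} [TopologicalSpace N] [ChartedSpace (Euc n) N]
  [IsManifold (𝓡 n) ∞ N]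

/-- `∇φ ⊗ ∇φ`, that is the pull-back `φ^* γ`. -/
def gradTensor (γ : Metric n N) (φ : M → N) (x : M) (v w : TangentSpace (𝓡 m) x) : ℝ :=
  γ.inner (φ x) (mfderiv (𝓡 m) (𝓡 n) φ x v) (mfderiv (𝓡 m) (𝓡 n) φ x w)

/-- The tensor `𝒮 = Ric - κ ∇φ ⊗ ∇φ`. -/
def tensorS (γ : Metric n N) (κ : ℝ) (g : Metric m M) (φ : M → N) (x : M)
    (v w : TangentSpace (𝓡 m) x) : ℝ :=
  ricci g x v w - κ * gradTensor γ φ x v w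

/-- The scalar `S = R - κ |∇φ|²`. -/
def scalarS (γ : Metric n N) (κ : ℝ) (g : Metric m M) (φ : M → N) (x : M) : ℝ :=
  metricTrace g x (ricci g x) - κ * metricTrace g x (gradTensor γ φ x)

/-- The `a`-th component of `φ`, read in the charts at `x` and at `φ x`. -/
def mapInCharts (φ : M → N) (x : M) (a : Fin n) (y : Euc m) : ℝ :=
  (extChartAt (𝓡 n) (φ x) (φ ((extChartAt (𝓡 m) x).symm y))) a

/-- The tension field `τ_g φ`, computed in the charts at `x` and at `φ x`:
`τᵃ = gⁱʲ (∂ᵢ∂ⱼ φᵃ - Γᵏᵢⱼ ∂ₖ φᵃ + Γᵃ_bc(φ) ∂ᵢ φᵇ ∂ⱼ φᶜ)`. -/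
def tension (γ : Metric n N) (g : Metric m M) (φ : M → N) (x : M) : TangentSpace (𝓡 n) (φ x) :=
  let y₀ : Euc m := extChartAt (𝓡 m) x x
  let z₀ : Euc n := extChartAt (𝓡 n) (φ x) (φ x)
  let G := gramInChart g x
  let F := mapInCharts φ x
  ∑ a, (∑ i, ∑ j, (G y₀)⁻¹ i j *
      (partialD i (partialD j (F a)) y₀
        - ∑ k, christoffel G k i j y₀ * partialD k (F a) y₀
        + ∑ b, ∑ c, christoffel (gramInChart γ (φ x)) a b c z₀
            * partialD i (F b) y₀ * partialD j (F c) y₀)) • tangentVec (φ x) a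

/-- The time interval `[0, T)`, where `T` may be `∞`. -/
def timeDomain (T : EReal) : Set ℝ := {t | 0 ≤ t ∧ (t : EReal) < T}

/-- `(g(t), φ(t))`, `t ∈ [0, T)`, is a smooth solution of the Ricci flow coupled with the harmonic
map flow, with coupling constant `κ` and target `(N, γ)`:
`∂ₜ g = -2 Ric + 2 κ ∇φ ⊗ ∇φ`, `∂ₜ φ = τ_g φ`. -/
structure IsRHFlow (γ : Metric n N) (κ : ℝ) (T : EReal) (g : ℝ → Metric m M) (φ : ℝ → M → N) :
    Prop where
  /-- The metric coefficients in each chart are smooth in space and time. -/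
  smooth_metric : ∀ (c : M) (i j : Fin m),
    ContDiffOn ℝ ∞ (fun z : ℝ × Euc m => gramInChart (g z.1) c z.2 i j)
      (timeDomain T ×ˢ (extChartAt (𝓡 m) c).target)
  /-- The maps are smooth in space and time. -/
  smooth_map : ContMDiffOn (𝓘(ℝ, ℝ).prod (𝓡 m)) (𝓡 n) ∞ (fun z : ℝ × M => φ z.1 z.2)
    (timeDomain T ×ˢ Set.univ)
  metric_eq : ∀ t ∈ timeDomain T, ∀ (x : M) (v w : TangentSpace (𝓡 m) x),
    HasDerivWithinAt (fun s => (g s).inner x v w)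
      (-2 * ricci (g t) x v w + 2 * κ * gradTensor γ (φ t) x v w) (timeDomain T) t
  map_eq : ∀ t ∈ timeDomain T, ∀ x : M,
    HasMFDerivWithinAt 𝓘(ℝ, ℝ) (𝓡 n) (fun s => φ s x) (timeDomain T) t
      (ContinuousLinearMap.toSpanSingleton ℝ (tension γ (g t) (φ t) x))

end Maps

/-! ### Sobolev functions -/

/-- `ξ` is the weak differential of `u`: in every chart, `u` and the components of `ξ` are locally
integrable, and the components of `ξ` are the weak partial derivatives of `u`. -/
def IsWeakDifferential (u : M → ℝ) (ξ : ∀ x : M, TangentSpace (𝓡 m) x →L[ℝ] ℝ) : Prop :=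
  ∀ c : M,
    LocallyIntegrableOn (fun y => u ((extChartAt (𝓡 m) c).symm y)) (extChartAt (𝓡 m) c).target ∧
    ∀ i : Fin m,
      LocallyIntegrableOn (fun y => ξ ((extChartAt (𝓡 m) c).symm y) (chartFrame c y i))
        (extChartAt (𝓡 m) c).target ∧
      ∀ ψ : Euc m → ℝ, ContDiff ℝ ∞ ψ → HasCompactSupport ψ →
        tsupport ψ ⊆ (extChartAt (𝓡 m) c).target →
        ∫ y in (extChartAt (𝓡 m) c).target,
            u ((extChartAt (𝓡 m) c).symm y) * partialD i ψ y
          = - ∫ y in (extChartAt (𝓡 m) c).target,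
            ξ ((extChartAt (𝓡 m) c).symm y) (chartFrame c y i) * ψ y

open Classical in
/-- The weak differential of `u` (determined up to a null set; zero if there is none). -/
def weakDifferential (u : M → ℝ) : ∀ x : M, TangentSpace (𝓡 m) x →L[ℝ] ℝ :=
  if h : ∃ ξ : ∀ x : M, TangentSpace (𝓡 m) x →L[ℝ] ℝ, IsWeakDifferential u ξ
  then h.choose else fun _ => 0

/-- The gradient `∇u` with respect to `g`. -/
def gradient (g : Metric m M) (u : M → ℝ) (x : M) : TangentSpace (𝓡 m) x :=
  sharp g x (weakDifferential u x)

/-- `|∇u|`, with respect to `g`. -/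
def gradNorm (g : Metric m M) (u : M → ℝ) (x : M) : ℝ :=
  Real.sqrt (g.inner x (gradient g u x) (gradient g u x))

variable [CompactSpace M] [MeasurableSpace M] [BorelSpace M]

/-! ### The Riemannian volume -/

/-- A finite set of chart centres whose charts cover the compact manifold `M`. -/
def chartCover (m : ℕ) (M : Type*) [TopologicalSpace M] [ChartedSpace (Euc m) M]
    [CompactSpace M] : Finset M :=
  (exists_chartCover m M).choose

/-- The measure `√(det g_ij) dy¹ ⋯ dyᵐ` on the domain of the chart at `c`, as a measure on `M`. -/
def chartVolume (g : Metric m M) (c : M) : Measure M :=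
  ((volume.restrict (extChartAt (𝓡 m) c).target).withDensity
    (fun y => ENNReal.ofReal (Real.sqrt (gramInChart g c y).det))).map (extChartAt (𝓡 m) c).symm

open Classical in
/-- The Riemannian volume measure `μ_g`: the measures `√(det g_ij) dy` of a finite atlas, glued
with the partition of unity which gives each of the charts around a point the same weight. -/
def riemannianVolume (g : Metric m M) : Measure M :=
  ∑ c ∈ chartCover m M, (chartVolume g c).withDensity fun x =>
    (((chartCover m M).filter fun d => x ∈ (extChartAt (𝓡 m) d).source).card : ENNReal)⁻¹

/-- `u ∈ W^{1,p}(M)`: `u` and its weak gradient are in `L^p`. -/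
def MemW (g : Metric m M) (p : ℝ) (u : M → ℝ) : Prop :=
  MemLp u (ENNReal.ofReal p) (riemannianVolume g) ∧
  (∃ ξ : ∀ x : M, TangentSpace (𝓡 m) x →L[ℝ] ℝ, IsWeakDifferential u ξ) ∧
  MemLp (gradNorm g u) (ENNReal.ofReal p) (riemannianVolume g)

/-! ### The eigenvalue problem -/

/-- The energy `G(g,u,v) = (α+1)/p ∫ |∇u|^p dμ + (β+1)/q ∫ |∇v|^q dμ`. -/
def energy (p q α β : ℝ) (g : Metric m M) (u v : M → ℝ) : ℝ :=
  (α + 1) / p * ∫ x, gradNorm g u x ^ p ∂(riemannianVolume g)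
    + (β + 1) / q * ∫ x, gradNorm g v x ^ q ∂(riemannianVolume g)

/-- `B(u,v) = ∫ |u|^α |v|^β u v dμ`. -/
def coupling (α β : ℝ) (g : Metric m M) (u v : M → ℝ) : ℝ :=
  ∫ x, |u x| ^ α * |v x| ^ β * u x * v x ∂(riemannianVolume g)

/-- The two classes of competitors for the first eigenvalue: all normalized pairs, or those
normalized pairs that satisfy the two balancing conditions that every eigenfunction pair with a
nonzero eigenvalue satisfies. -/
inductive Competitors where
  | normalized
  | balanced

/-- The additional conditions `∫ |u|^α |v|^β v dμ = 0 = ∫ |u|^α |v|^β u dμ` (void for the class of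
all normalized pairs). -/
def Competitors.Condition (K : Competitors) (α β : ℝ) (g : Metric m M) (u v : M → ℝ) : Prop :=
  match K with
  | .normalized => True
  | .balanced =>
      ∫ x, |u x| ^ α * |v x| ^ β * v x ∂(riemannianVolume g) = 0 ∧
      ∫ x, |u x| ^ α * |v x| ^ β * u x ∂(riemannianVolume g) = 0

/-- `(u,v)` is a competitor: `(u,v) ∈ W^{1,p} × W^{1,q}`, `B(u,v) = 1`, and the additional
conditions of the class hold. -/
def Admissible (K : Competitors) (p q α β : ℝ) (g : Metric m M) (u v : M → ℝ) : Prop :=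
  MemW g p u ∧ MemW g q v ∧ coupling α β g u v = 1 ∧ K.Condition α β g u v

/-- The first eigenvalue: the infimum of the energy over the competitors. -/
def firstEigenvalue (K : Competitors) (p q α β : ℝ) (g : Metric m M) : ℝ :=
  sInf {e | ∃ u v : M → ℝ, Admissible K p q α β g u v ∧ e = energy p q α β g u v}

/-- `(u,v)` is a weak solution of `Δ_p u = -Λ |u|^α |v|^β v`, `Δ_q v = -Λ |u|^α |v|^β u`. -/
def IsWeakSolution (p q α β : ℝ) (g : Metric m M) (Λ : ℝ) (u v : M → ℝ) : Prop :=
  (∀ f : M → ℝ, MemW g p f →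
    ∫ x, gradNorm g u x ^ (p - 2) * g.inner x (gradient g u x) (gradient g f x)
        ∂(riemannianVolume g)
      = Λ * ∫ x, |u x| ^ α * |v x| ^ β * v x * f x ∂(riemannianVolume g)) ∧
  (∀ f : M → ℝ, MemW g q f →
    ∫ x, gradNorm g v x ^ (q - 2) * g.inner x (gradient g v x) (gradient g f x)
        ∂(riemannianVolume g)
      = Λ * ∫ x, |u x| ^ α * |v x| ^ β * u x * f x ∂(riemannianVolume g))

/-- `(u,v)` is a normalized pair of eigenfunctions of the first eigenvalue `λ`: a competitor which
solves the weak system with `Λ = λ`, or which realizes the infimum `λ` of the energy. -/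
def IsFirstEigenpair (K : Competitors) (p q α β : ℝ) (g : Metric m M) (u v : M → ℝ) : Prop :=
  Admissible K p q α β g u v ∧
  (IsWeakSolution p q α β g (firstEigenvalue K p q α β g) u v ∨
    energy p q α β g u v = firstEigenvalue K p q α β g)

/-! ### The normalized family through the eigenfunctions at time `t₁` -/

/-- `h(t) = w [det g(t₁) / det g(t)]^{1 / (2(α+β+1))}`. The quotient of the determinants does not
depend on the basis of `T_x M`. -/
def rescaled (α β : ℝ) (g : ℝ → Metric m M) (t₁ : ℝ) (w : M → ℝ) (t : ℝ) (x : M) : ℝ :=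
  w x * ((gram (g t₁) x).det / (gram (g t) x).det) ^ (1 / (2 * (α + β + 1)))

/-- `∫ |h(t)|^α |l(t)|^β h(t) l(t) dμ_{g(t)}`, where `h`, `l` are the rescalings of `u₁`, `v₁`. -/
def normalizer (α β : ℝ) (g : ℝ → Metric m M) (t₁ : ℝ) (u₁ v₁ : M → ℝ) (t : ℝ) : ℝ :=
  coupling α β (g t) (rescaled α β g t₁ u₁ t) (rescaled α β g t₁ v₁ t)

/-- `u(t) = h(t) / (∫ |h|^α |l|^β h l dμ)^{1/p}`. -/
def familyU (p α β : ℝ) (g : ℝ → Metric m M) (t₁ : ℝ) (u₁ v₁ : M → ℝ) (t : ℝ) (x : M) : ℝ :=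
  rescaled α β g t₁ u₁ t x / normalizer α β g t₁ u₁ v₁ t ^ (1 / p)

/-- `v(t) = l(t) / (∫ |h|^α |l|^β h l dμ)^{1/q}`. -/
def familyV (q α β : ℝ) (g : ℝ → Metric m M) (t₁ : ℝ) (u₁ v₁ : M → ℝ) (t : ℝ) (x : M) : ℝ :=
  rescaled α β g t₁ v₁ t x / normalizer α β g t₁ u₁ v₁ t ^ (1 / q)

/-- The time derivative `w' = ∂ₜ w` on `[0, T)`. -/
def timeDeriv (T : EReal) (w : ℝ → M → ℝ) (t : ℝ) (x : M) : ℝ :=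
  derivWithin (fun s => w s x) (timeDomain T) t

/-- `𝒢 = (α+1) ∫ (𝒮(∇u,∇u) + ⟨∇u',∇u⟩) |∇u|^{p-2} dμ + (β+1) ∫ (𝒮(∇v,∇v) + ⟨∇v',∇v⟩) |∇v|^{q-2} dμ
- (α+1)/p ∫ |∇u|^p S dμ - (β+1)/q ∫ |∇v|^q S dμ`. -/
def energyRate {n : ℕ} {N : Type*} [TopologicalSpace N] [ChartedSpace (Euc n) N]
    [IsManifold (𝓡 n) ∞ N] (p q α β : ℝ) (γ : Metric n N) (κ : ℝ) (g : Metric m M) (φ : M → N)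
    (u u' v v' : M → ℝ) : ℝ :=
  (α + 1) * (∫ x, (tensorS γ κ g φ x (gradient g u x) (gradient g u x)
        + g.inner x (gradient g u' x) (gradient g u x)) * gradNorm g u x ^ (p - 2)
      ∂(riemannianVolume g))
    + (β + 1) * (∫ x, (tensorS γ κ g φ x (gradient g v x) (gradient g v x)
        + g.inner x (gradient g v' x) (gradient g v x)) * gradNorm g v x ^ (q - 2)
      ∂(riemannianVolume g))
    - (α + 1) / p * (∫ x, gradNorm g u x ^ p * scalarS γ κ g φ x ∂(riemannianVolume g))
    - (β + 1) / q * (∫ x, gradNorm g v x ^ q * scalarS γ κ g φ x ∂(riemannianVolume g))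

end Manifold

end RHFlow

end

open RHFlow

/-!
Write `u(t) = a(t) u₁`, where `a(t, x)` is a smooth positive function, and transport all integrals
to time `t₁`: by Jacobi's formula and the flow equation `∂ₜ g = -2𝒮`, the Riemannian measures are
related by a smooth density which solves `∂ₜ (dμ) = -S dμ`. The exponent in the rescaling makes
`|h|^α |l|^β h dμ` independent of time, which preserves the balancing conditions, and dividing by
powers of `n(t)` normalizes `B`. The function `n` is smooth in time since it is the integral of a
smooth family of functions against a fixed integrable weight
(`SmoothMetric.contDiffOn_normalizer`).

The heart of the matter is the evolution of `∫ |∇u(t)|^p dμ`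
(`EvolvesBy.hasDerivWithinAt_dirichlet`). The weak differential of `u(t)` is `a du₁ + u₁ da` almost
everywhere (`IsWeakDifferential.smooth_mul`, `IsWeakDifferential.ae_eq`), so that at almost every
point the integrand is a power of the dual norm of an explicitly moving covector, and
`∂ₜ |θ|² = 2 𝒮(θ♯, θ♯) + 2 ⟨θ', θ⟩` because the inverse of the Gram matrix is differentiated along
`∂ₜ g = -2𝒮`. The power `p > 1` of the norm is differentiable also where the covector vanishes,
since the norm vanishes there to first order. By compactness of `[t₀, t₁] × M` the derivative of the
integrand is dominated by a multiple of `(|du₁| + |u₁|)^p`, which is integrable, and one may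
differentiate under the integral sign.

Hence the energy has the bounded derivative `𝒢`, and the fundamental theorem of calculus gives
`G(t₁) - G(t₀) = ∫ 𝒢`. At time `t₁` the energy equals `λ(t₁)`, by testing the system with the
solution itself, and at time `t₀` it is at least `λ(t₀)` by definition of the infimum.
-/

noncomputable section

namespace RHFlow

open Filter Topology Set Matrix Asymptotics

/-! ### The metric at a point -/

section Pointwise

variable {m : ℕ} {M : Type*} [TopologicalSpace M] [ChartedSpace (Euc m) M]
  [IsManifold (𝓡 m) ∞ M]

/-- The standard basis of `T_x M`, as a basis. -/
def tangentBasis (x : M) : Module.Basis (Fin m) ℝ (TangentSpace (𝓡 m) x) :=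
  (EuclideanSpace.basisFun (Fin m) ℝ).toBasis

omit [IsManifold (𝓡 m) ∞ M] in
theorem tangentBasis_apply (x : M) (i : Fin m) : tangentBasis x i = tangentVec x i := by
  simp only [tangentBasis, tangentVec, stdVec]
  exact EuclideanSpace.basisFun_apply (Fin m) ℝ i

/-- The coordinate frame of a chart, as a basis. -/
theorem exists_chartBasis (c : M) {y : Euc m} (hy : y ∈ (extChartAt (𝓡 m) c).target) :
    ∃ b : Module.Basis (Fin m) ℝ (TangentSpace (𝓡 m) ((extChartAt (𝓡 m) c).symm y)),
      ∀ i, b i = chartFrame c y i := by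
  have h := isInvertible_mfderivWithin_extChartAt_symm (I := 𝓡 m) (x := c) hy
  rw [ModelWithCorners.range_eq_univ, mfderivWithin_univ] at h
  obtain ⟨e, he⟩ := h
  let b₀ : Module.Basis (Fin m) ℝ (TangentSpace 𝓘(ℝ, Euc m) y) :=
    (EuclideanSpace.basisFun (Fin m) ℝ).toBasis
  refine ⟨b₀.map e.toLinearEquiv, fun i => ?_⟩
  have hi : b₀ i = stdVec m i := EuclideanSpace.basisFun_apply (Fin m) ℝ i
  rw [Module.Basis.map_apply, hi, chartFrame, ← he]
  rfl

theorem inner_sum_sum (g : Metric m M) (x : M) (e : Fin m → TangentSpace (𝓡 m) x)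
    (a c : Fin m → ℝ) :
    g.inner x (∑ i, a i • e i) (∑ j, c j • e j)
      = ∑ i, ∑ j, a i * c j * g.inner x (e i) (e j) := by
  simp only [map_sum, map_smul, FunLike.coe_sum, Finset.sum_apply, FunLike.coe_smul,
    Pi.smul_apply, smul_eq_mul, Finset.mul_sum]
  rw [Finset.sum_comm]
  refine Finset.sum_congr rfl fun i _ => Finset.sum_congr rfl fun j _ => ?_
  ring

/-- The matrix of the metric in a basis of `T_x M`. -/
def gramOf (g : Metric m M) (x : M) (b : Module.Basis (Fin m) ℝ (TangentSpace (𝓡 m) x)) :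
    Matrix (Fin m) (Fin m) ℝ :=
  Matrix.of fun i j => g.inner x (b i) (b j)

theorem gramOf_tangentBasis (g : Metric m M) (x : M) : gramOf g x (tangentBasis x) = gram g x := by
  ext i j
  simp [gramOf, gram, tangentBasis_apply]

theorem gramOf_posDef (g : Metric m M) (x : M)
    (b : Module.Basis (Fin m) ℝ (TangentSpace (𝓡 m) x)) : (gramOf g x b).PosDef := by
  rw [Matrix.posDef_iff_dotProduct_mulVec]
  refine ⟨?_, fun a ha => ?_⟩
  · ext i j
    simp [gramOf, g.symm x (b i) (b j)]
  · have h : star a ⬝ᵥ gramOf g x b *ᵥ a = g.inner x (∑ i, a i • b i) (∑ i, a i • b i) := by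
      rw [inner_sum_sum]
      simp only [dotProduct, mulVec, gramOf, Finset.mul_sum, star_trivial, Matrix.of_apply]
      refine Finset.sum_congr rfl fun i _ => Finset.sum_congr rfl fun j _ => ?_
      ring
    rw [h]
    refine g.pos x _ fun h0 => ha ?_
    funext i
    exact (Fintype.linearIndependent_iff.1 b.linearIndependent) a h0 i

theorem gram_posDef (g : Metric m M) (x : M) : (gram g x).PosDef :=
  gramOf_tangentBasis g x ▸ gramOf_posDef g x _

theorem gramInChart_eq_gramOf (g : Metric m M) (c : M) {y : Euc m}
    {b : Module.Basis (Fin m) ℝ (TangentSpace (𝓡 m) ((extChartAt (𝓡 m) c).symm y))}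
    (hb : ∀ i, b i = chartFrame c y i) :
    gramInChart g c y = gramOf g ((extChartAt (𝓡 m) c).symm y) b := by
  ext i j
  simp only [gramOf, gramInChart, Matrix.of_apply, hb]

theorem gramInChart_posDef (g : Metric m M) (c : M) {y : Euc m}
    (hy : y ∈ (extChartAt (𝓡 m) c).target) : (gramInChart g c y).PosDef := by
  obtain ⟨b, hb⟩ := exists_chartBasis c hy
  rw [gramInChart_eq_gramOf g c hb]
  exact gramOf_posDef g _ b

theorem det_gramOf (g : Metric m M) (x : M)
    (b b' : Module.Basis (Fin m) ℝ (TangentSpace (𝓡 m) x)) :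
    (gramOf g x b').det = (b.toMatrix b').det ^ 2 * (gramOf g x b).det := by
  have h : gramOf g x b' = (b.toMatrix b')ᵀ * gramOf g x b * b.toMatrix b' := by
    ext i j
    simp only [gramOf, Matrix.of_apply, mul_apply, transpose_apply, Finset.sum_mul]
    conv_lhs => rw [← b.sum_toMatrix_smul_self b' i, ← b.sum_toMatrix_smul_self b' j]
    rw [inner_sum_sum, Finset.sum_comm]
    refine Finset.sum_congr rfl fun k _ => Finset.sum_congr rfl fun l _ => ?_
    ring
  rw [h, det_mul, det_mul, det_transpose]
  ring

omit [IsManifold (𝓡 m) ∞ M] in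
theorem det_toMatrix_ne_zero {x : M} (b b' : Module.Basis (Fin m) ℝ (TangentSpace (𝓡 m) x)) :
    (b.toMatrix b').det ≠ 0 := by
  have h := congrArg Matrix.det (b.toMatrix_mul_toMatrix_flip b')
  rw [det_mul, det_one] at h
  exact left_ne_zero_of_mul (h.trans_ne one_ne_zero)

/-- The quotient of the determinants of two metrics may be computed in any chart. -/
theorem gram_det_div_eq (g₁ g₂ : Metric m M) (c : M) {y : Euc m}
    (hy : y ∈ (extChartAt (𝓡 m) c).target) :
    (gram g₁ ((extChartAt (𝓡 m) c).symm y)).det / (gram g₂ ((extChartAt (𝓡 m) c).symm y)).det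
      = (gramInChart g₁ c y).det / (gramInChart g₂ c y).det := by
  obtain ⟨b, hb⟩ := exists_chartBasis c hy
  rw [gramInChart_eq_gramOf g₁ c hb, gramInChart_eq_gramOf g₂ c hb,
    det_gramOf g₁ _ (tangentBasis _) b, det_gramOf g₂ _ (tangentBasis _) b,
    gramOf_tangentBasis, gramOf_tangentBasis, mul_div_mul_left]
  exact pow_ne_zero 2 (det_toMatrix_ne_zero _ _)

/-- `ξ♯` is the Riesz representative of `ξ`, and may be computed in any basis. -/
theorem inner_sum_inv_gramOf (g : Metric m M) (x : M)
    (b : Module.Basis (Fin m) ℝ (TangentSpace (𝓡 m) x)) (ξ : TangentSpace (𝓡 m) x →L[ℝ] ℝ)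
    (v : TangentSpace (𝓡 m) x) :
    g.inner x (∑ i, (∑ j, (gramOf g x b)⁻¹ i j * ξ (b j)) • b i) v = ξ v := by
  have hv : v = ∑ k, b.repr v k • b k := (b.sum_repr v).symm
  have hsymm : ∀ i j, (gramOf g x b)⁻¹ i j = (gramOf g x b)⁻¹ j i := fun i j => by
    have := (gramOf_posDef g x b).isHermitian.inv.apply i j
    simpa using this.symm
  have hinv : (gramOf g x b)⁻¹ * gramOf g x b = 1 :=
    Matrix.nonsing_inv_mul _ (gramOf_posDef g x b).det_pos.ne'.isUnit
  conv_lhs => rw [hv]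
  conv_rhs => rw [hv]
  rw [inner_sum_sum, Finset.sum_comm, map_sum]
  refine Finset.sum_congr rfl fun k _ => ?_
  rw [map_smul, smul_eq_mul]
  have : ∀ j, ∑ i, (gramOf g x b)⁻¹ j i * g.inner x (b i) (b k) = (1 : Matrix _ _ ℝ) j k :=
    fun j => by rw [← hinv]; rfl
  calc ∑ i, (∑ j, (gramOf g x b)⁻¹ i j * ξ (b j)) * b.repr v k * g.inner x (b i) (b k)
      = b.repr v k * ∑ j, ξ (b j) * ∑ i, (gramOf g x b)⁻¹ j i * g.inner x (b i) (b k) := by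
        simp only [Finset.sum_mul, Finset.mul_sum]
        rw [Finset.sum_comm]
        refine Finset.sum_congr rfl fun j _ => Finset.sum_congr rfl fun i _ => ?_
        rw [hsymm j i]; ring
    _ = b.repr v k * ξ (b k) := by simp [this, Matrix.one_apply]

theorem inner_sharp (g : Metric m M) (x : M) (ξ : TangentSpace (𝓡 m) x →L[ℝ] ℝ)
    (v : TangentSpace (𝓡 m) x) : g.inner x (sharp g x ξ) v = ξ v := by
  have := inner_sum_inv_gramOf g x (tangentBasis x) ξ v
  simpa only [gramOf_tangentBasis, tangentBasis_apply, sharp] using this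

theorem inner_self_nonneg (g : Metric m M) (x : M) (v : TangentSpace (𝓡 m) x) :
    0 ≤ g.inner x v v := by
  rcases eq_or_ne v 0 with rfl | hv
  · simp
  · exact (g.pos x v hv).le

theorem eq_of_inner_eq (g : Metric m M) (x : M) {v w : TangentSpace (𝓡 m) x}
    (h : ∀ z, g.inner x v z = g.inner x w z) : v = w := by
  by_contra hne
  have h1 := g.pos x (v - w) (sub_ne_zero.2 hne)
  have h2 : g.inner x (v - w) (v - w) = g.inner x v (v - w) - g.inner x w (v - w) := by
    rw [map_sub (g.inner x)]
    rfl
  rw [h2, h, sub_self] at h1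
  exact lt_irrefl _ h1

theorem sharp_eq_sum (g : Metric m M) (x : M)
    (b : Module.Basis (Fin m) ℝ (TangentSpace (𝓡 m) x)) (ξ : TangentSpace (𝓡 m) x →L[ℝ] ℝ) :
    sharp g x ξ = ∑ i, (∑ j, (gramOf g x b)⁻¹ i j * ξ (b j)) • b i :=
  eq_of_inner_eq g x fun z => by rw [inner_sharp, inner_sum_inv_gramOf]

theorem sharp_add (g : Metric m M) (x : M) (ξ η : TangentSpace (𝓡 m) x →L[ℝ] ℝ) :
    sharp g x (ξ + η) = sharp g x ξ + sharp g x η :=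
  eq_of_inner_eq g x fun z => by simp [inner_sharp]

theorem sharp_smul (g : Metric m M) (x : M) (a : ℝ) (ξ : TangentSpace (𝓡 m) x →L[ℝ] ℝ) :
    sharp g x (a • ξ) = a • sharp g x ξ :=
  eq_of_inner_eq g x fun z => by simp [inner_sharp]

/-- The Cauchy-Schwarz inequality, squared. -/
theorem inner_sq_le (g : Metric m M) (x : M) (v w : TangentSpace (𝓡 m) x) :
    g.inner x v w ^ 2 ≤ g.inner x v v * g.inner x w w := by
  have key : ∀ t : ℝ, 0 ≤ g.inner x w w * (t * t) + 2 * g.inner x v w * t + g.inner x v v := by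
    intro t
    have := inner_self_nonneg g x (v + t • w)
    simp only [map_add, map_smul, FunLike.coe_add, FunLike.coe_smul, Pi.add_apply,
      Pi.smul_apply, smul_eq_mul, g.symm x w v] at this
    linarith
  have := discrim_le_zero key
  rw [discrim] at this
  nlinarith

/-- The norm `|ξ|_g` of a covector. -/
def conorm (g : Metric m M) (x : M) (ξ : TangentSpace (𝓡 m) x →L[ℝ] ℝ) : ℝ :=
  Real.sqrt (g.inner x (sharp g x ξ) (sharp g x ξ))

theorem conorm_nonneg (g : Metric m M) (x : M) (ξ : TangentSpace (𝓡 m) x →L[ℝ] ℝ) :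
    0 ≤ conorm g x ξ := Real.sqrt_nonneg _

theorem conorm_sq (g : Metric m M) (x : M) (ξ : TangentSpace (𝓡 m) x →L[ℝ] ℝ) :
    conorm g x ξ ^ 2 = g.inner x (sharp g x ξ) (sharp g x ξ) :=
  Real.sq_sqrt (inner_self_nonneg g x _)

theorem abs_inner_sharp_le (g : Metric m M) (x : M) (ξ η : TangentSpace (𝓡 m) x →L[ℝ] ℝ) :
    |g.inner x (sharp g x ξ) (sharp g x η)| ≤ conorm g x ξ * conorm g x η := by
  refine abs_le_of_sq_le_sq ?_ (mul_nonneg (conorm_nonneg ..) (conorm_nonneg ..))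
  rw [mul_pow, conorm_sq, conorm_sq]
  exact inner_sq_le g x _ _

theorem conorm_add_le (g : Metric m M) (x : M) (ξ η : TangentSpace (𝓡 m) x →L[ℝ] ℝ) :
    conorm g x (ξ + η) ≤ conorm g x ξ + conorm g x η := by
  refine le_of_sq_le_sq ?_ (add_nonneg (conorm_nonneg ..) (conorm_nonneg ..))
  rw [conorm_sq, sharp_add, add_sq, conorm_sq, conorm_sq]
  have := (le_abs_self _).trans (abs_inner_sharp_le g x ξ η)
  simp only [map_add, FunLike.coe_add, Pi.add_apply, g.symm x (sharp g x η) (sharp g x ξ)]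
  linarith

theorem conorm_smul (g : Metric m M) (x : M) (a : ℝ) (ξ : TangentSpace (𝓡 m) x →L[ℝ] ℝ) :
    conorm g x (a • ξ) = |a| * conorm g x ξ := by
  rw [conorm, sharp_smul]
  simp only [map_smul, FunLike.coe_smul, Pi.smul_apply, smul_eq_mul, ← mul_assoc]
  rw [Real.sqrt_mul (mul_self_nonneg a), Real.sqrt_mul_self_eq_abs, conorm]

/-- A covector which is bounded by `C` on unit vectors has norm at most `C`. -/
theorem conorm_le_of_sq_le (g : Metric m M) (x : M) (ξ : TangentSpace (𝓡 m) x →L[ℝ] ℝ) {C : ℝ}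
    (hC : 0 ≤ C) (h : ∀ v, ξ v ^ 2 ≤ C ^ 2 * g.inner x v v) : conorm g x ξ ≤ C := by
  have h1 := h (sharp g x ξ)
  rw [← inner_sharp g x ξ, ← conorm_sq] at h1
  rcases (conorm_nonneg g x ξ).eq_or_lt with h0 | h0
  · rw [← h0]; exact hC
  · refine le_of_sq_le_sq ?_ hC
    exact le_of_mul_le_mul_right (by rw [← sq]; exact h1) (pow_pos h0 2)

/-- If `g₁ ≤ C² g₂`, then the dual norms satisfy the opposite inequality. -/
theorem conorm_le_of_inner_le (g₁ g₂ : Metric m M) (x : M) (ξ : TangentSpace (𝓡 m) x →L[ℝ] ℝ)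
    {C : ℝ} (hC : 0 ≤ C) (h : ∀ v, g₁.inner x v v ≤ C ^ 2 * g₂.inner x v v) :
    conorm g₂ x ξ ≤ C * conorm g₁ x ξ := by
  refine conorm_le_of_sq_le g₂ x ξ (mul_nonneg hC (conorm_nonneg ..)) fun v => ?_
  rw [← inner_sharp g₁ x ξ]
  refine (inner_sq_le g₁ x _ _).trans ?_
  rw [← conorm_sq, mul_pow, mul_comm (C ^ 2), mul_assoc]
  exact mul_le_mul_of_nonneg_left (h v) (sq_nonneg _)

/-- The norm of a covector in terms of its components in a basis. -/
theorem conorm_sq_eq_sum (g : Metric m M) (x : M)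
    (b : Module.Basis (Fin m) ℝ (TangentSpace (𝓡 m) x)) (ξ : TangentSpace (𝓡 m) x →L[ℝ] ℝ) :
    conorm g x ξ ^ 2 = ∑ i, ∑ j, (gramOf g x b)⁻¹ i j * ξ (b j) * ξ (b i) := by
  rw [conorm_sq, inner_sharp, sharp_eq_sum g x b, map_sum]
  simp [Finset.sum_mul]

end Pointwise

/-! ### Smooth families of functions and metrics -/

section Families

variable {m : ℕ} {M : Type*} [TopologicalSpace M] [ChartedSpace (Euc m) M]

/-- The family `r t`, `t ∈ D`, of functions on `M` is smooth in space and time. This is phrased in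
charts, so that `D` may be an interval with end points. -/
def SmoothFamily (D : Set ℝ) (r : ℝ → M → ℝ) : Prop :=
  ∀ c : M, ContDiffOn ℝ ∞ (fun z : ℝ × Euc m => r z.1 ((extChartAt (𝓡 m) c).symm z.2))
    (D ×ˢ (extChartAt (𝓡 m) c).target)

/-- The time derivative of a family of functions, within the time set `D`. -/
def timeD (D : Set ℝ) (r : ℝ → M → ℝ) (t : ℝ) (x : M) : ℝ := derivWithin (fun s => r s x) D t

/-- The differential of a function, as a covector. -/
def dcov (f : M → ℝ) (x : M) : TangentSpace (𝓡 m) x →L[ℝ] ℝ := mfderiv (𝓡 m) 𝓘(ℝ, ℝ) f x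

theorem extChartAt_target_isOpen (c : M) : IsOpen (extChartAt (𝓡 m) c).target :=
  isOpen_extChartAt_target c

theorem exists_chart_eq (x : M) :
    ∃ y ∈ (extChartAt (𝓡 m) x).target, (extChartAt (𝓡 m) x).symm y = x :=
  ⟨extChartAt (𝓡 m) x x, mem_extChartAt_target x, extChartAt_to_inv x⟩

namespace SmoothFamily

variable {D D' : Set ℝ} {r r' : ℝ → M → ℝ}

theorem mono (hr : SmoothFamily (m := m) D r) (h : D' ⊆ D) : SmoothFamily (m := m) D' r :=
  fun c => (hr c).mono (prod_mono h Subset.rfl)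

theorem congr (hr : SmoothFamily (m := m) D r) (h : ∀ t ∈ D, ∀ x, r' t x = r t x) :
    SmoothFamily (m := m) D r' :=
  fun c => (hr c).congr fun z hz => h z.1 hz.1 _

theorem mul (hr : SmoothFamily (m := m) D r) (hr' : SmoothFamily (m := m) D r') :
    SmoothFamily (m := m) D (fun t x => r t x * r' t x) :=
  fun c => (hr c).mul (hr' c)

theorem inv (hr : SmoothFamily (m := m) D r) (h0 : ∀ t ∈ D, ∀ x, r t x ≠ 0) :
    SmoothFamily (m := m) D (fun t x => (r t x)⁻¹) :=
  fun c => (hr c).inv fun z hz => h0 z.1 hz.1 _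

theorem rpow_const (hr : SmoothFamily (m := m) D r) (h0 : ∀ t ∈ D, ∀ x, r t x ≠ 0) (e : ℝ) :
    SmoothFamily (m := m) D (fun t x => r t x ^ e) :=
  fun c => (hr c).rpow_const_of_ne fun z hz => h0 z.1 hz.1 _

theorem of_time {k : ℝ → ℝ} (hk : ContDiffOn ℝ ∞ k D) :
    SmoothFamily (m := m) D (fun t (_ : M) => k t) :=
  fun _ => hk.comp contDiff_fst.contDiffOn fun _ hz => hz.1

theorem contDiffOn_time (hr : SmoothFamily (m := m) D r) (x : M) :
    ContDiffOn ℝ ∞ (fun t => r t x) D := by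
  obtain ⟨y, hy, hyx⟩ := exists_chart_eq (m := m) x
  have := (hr x).comp (f := fun t : ℝ => (t, y)) (s := D) (by fun_prop) fun t ht => ⟨ht, hy⟩
  simpa only [Function.comp_def, hyx] using this

theorem hasDerivWithinAt (hr : SmoothFamily (m := m) D r) {t : ℝ} (ht : t ∈ D) (x : M) :
    HasDerivWithinAt (fun s => r s x) (timeD D r t x) D t :=
  (((hr.contDiffOn_time x).differentiableOn (by simp)) t ht).hasDerivWithinAt

theorem contDiffOn_chart (hr : SmoothFamily (m := m) D r) {t : ℝ} (ht : t ∈ D) (c : M) :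
    ContDiffOn ℝ ∞ (fun y => r t ((extChartAt (𝓡 m) c).symm y)) (extChartAt (𝓡 m) c).target :=
  (hr c).comp (f := fun y : Euc m => (t, y)) (by fun_prop) fun y hy => ⟨ht, hy⟩

variable [IsManifold (𝓡 m) ∞ M]

theorem contMDiff (hr : SmoothFamily (m := m) D r) {t : ℝ} (ht : t ∈ D) :
    ContMDiff (𝓡 m) 𝓘(ℝ, ℝ) ∞ (r t) := by
  intro x
  have h1 := ((hr.contDiffOn_chart ht x).contMDiffOn).comp (contMDiffOn_extChartAt (n := ∞))
    (fun z hz => (extChartAt (𝓡 m) x).map_source (by rwa [extChartAt_source]))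
  have h2 : ContMDiffOn (𝓡 m) 𝓘(ℝ, ℝ) ∞ (r t) (chartAt (Euc m) x).source :=
    h1.congr fun z hz => by
      simp only [Function.comp_def]
      rw [(extChartAt (𝓡 m) x).left_inv (by rwa [extChartAt_source])]
  exact h2.contMDiffAt (chart_source_mem_nhds _ x)

theorem continuous (hr : SmoothFamily (m := m) D r) {t : ℝ} (ht : t ∈ D) : Continuous (r t) :=
  (hr.contMDiff ht).continuous

omit [IsManifold (𝓡 m) ∞ M] in
theorem fderivWithin_prod_left (hr : SmoothFamily (m := m) D r) (hD : UniqueDiffOn ℝ D) (c : M)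
    {t : ℝ} (ht : t ∈ D) {y : Euc m} (hy : y ∈ (extChartAt (𝓡 m) c).target) :
    fderivWithin ℝ (fun z : ℝ × Euc m => r z.1 ((extChartAt (𝓡 m) c).symm z.2))
      (D ×ˢ (extChartAt (𝓡 m) c).target) (t, y) (1, 0)
      = timeD D r t ((extChartAt (𝓡 m) c).symm y) := by
  have h1 := ((hr c).differentiableOn (by simp) (t, y) ⟨ht, hy⟩).hasFDerivWithinAt
  have h2 : HasDerivWithinAt (fun s : ℝ => (s, y)) ((1 : ℝ), (0 : Euc m)) D t :=
    ((hasDerivAt_id t).prodMk (hasDerivAt_const t y)).hasDerivWithinAt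
  have h3 := h1.comp_hasDerivWithinAt t h2 (t := D ×ˢ (extChartAt (𝓡 m) c).target)
    fun s hs => ⟨hs, hy⟩
  exact (h3.derivWithin (hD t ht)).symm

omit [IsManifold (𝓡 m) ∞ M] in
theorem fderivWithin_prod_right (hr : SmoothFamily (m := m) D r) (c : M)
    {t : ℝ} (ht : t ∈ D) {y : Euc m} (hy : y ∈ (extChartAt (𝓡 m) c).target) (w : Euc m) :
    fderivWithin ℝ (fun z : ℝ × Euc m => r z.1 ((extChartAt (𝓡 m) c).symm z.2))
      (D ×ˢ (extChartAt (𝓡 m) c).target) (t, y) (0, w)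
      = fderiv ℝ (fun y => r t ((extChartAt (𝓡 m) c).symm y)) y w := by
  have h1 := ((hr c).differentiableOn (by simp) (t, y) ⟨ht, hy⟩).hasFDerivWithinAt
  have h2 : HasFDerivWithinAt (fun y : Euc m => (t, y)) (ContinuousLinearMap.inr ℝ ℝ (Euc m))
      (extChartAt (𝓡 m) c).target y := by
    have := (hasFDerivAt_const (𝕜 := ℝ) t y).prodMk (hasFDerivAt_id (𝕜 := ℝ) y)
    exact this.hasFDerivWithinAt
  have h3 := h1.comp y h2 fun s hs => ⟨ht, hs⟩
  have h4 := h3.hasFDerivAt ((extChartAt_target_isOpen c).mem_nhds hy)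
  have h5 := h4.fderiv
  simp only [Function.comp_def] at h5
  rw [h5]
  rfl

omit [IsManifold (𝓡 m) ∞ M] in
theorem time_deriv (hr : SmoothFamily (m := m) D r) (hD : UniqueDiffOn ℝ D) :
    SmoothFamily (m := m) D (timeD D r) := by
  intro c
  have hU := hD.prod (extChartAt_target_isOpen (m := m) c).uniqueDiffOn
  have h1 := (hr c).fderivWithin hU (m := ∞) (by exact_mod_cast le_top)
  refine (h1.clm_apply (contDiffOn_const (c := ((1 : ℝ), (0 : Euc m))))).congr fun z hz => ?_
  exact (hr.fderivWithin_prod_left hD c hz.1 hz.2).symm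

/-- The differential in a chart. -/
theorem dcov_chartFrame (hr : SmoothFamily (m := m) D r) {t : ℝ} (ht : t ∈ D) (c : M) {y : Euc m}
    (hy : y ∈ (extChartAt (𝓡 m) c).target) (i : Fin m) :
    dcov (r t) ((extChartAt (𝓡 m) c).symm y) (chartFrame c y i)
      = partialD i (fun y => r t ((extChartAt (𝓡 m) c).symm y)) y := by
  have h1 : MDifferentiableAt (𝓡 m) 𝓘(ℝ, ℝ) (r t) ((extChartAt (𝓡 m) c).symm y) :=
    (hr.contMDiff ht _).mdifferentiableAt (by simp)
  have h2 : MDifferentiableAt 𝓘(ℝ, Euc m) (𝓡 m) (extChartAt (𝓡 m) c).symm y := by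
    have := mdifferentiableWithinAt_extChartAt_symm (I := 𝓡 m) hy
    rwa [ModelWithCorners.range_eq_univ, mdifferentiableWithinAt_univ] at this
  have h3 := mfderiv_comp y h1 h2
  rw [mfderiv_eq_fderiv] at h3
  exact (congrArg (fun L => L (stdVec m i)) h3).symm

/-- The differential of a smooth family commutes with the time derivative. -/
theorem hasDerivWithinAt_dcov (hr : SmoothFamily (m := m) D r) (hD : UniqueDiffOn ℝ D)
    (hD' : D ⊆ closure (interior D)) {t : ℝ} (ht : t ∈ D) (x : M) (v : TangentSpace (𝓡 m) x) :
    HasDerivWithinAt (fun s => dcov (r s) x v) (dcov (timeD D r t) x v) D t := by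
  obtain ⟨y, hy, hyx⟩ := exists_chart_eq (m := m) x
  obtain ⟨b, hb⟩ := exists_chartBasis x hy
  generalize hc : (extChartAt (𝓡 m) x) = e at *
  revert v
  rw [← hyx]
  intro v
  subst hc
  set S := D ×ˢ (extChartAt (𝓡 m) x).target with hS
  set f : ℝ × Euc m → ℝ := fun z => r z.1 ((extChartAt (𝓡 m) x).symm z.2) with hf
  have hU : UniqueDiffOn ℝ S := hD.prod (extChartAt_target_isOpen x).uniqueDiffOn
  have hfS : ContDiffOn ℝ ∞ f S := hr x
  have two_le : (2 : WithTop ℕ∞) ≤ ∞ := WithTop.coe_le_coe.2 (le_top : (2 : ℕ∞) ≤ ⊤)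
  have hsymm : IsSymmSndFDerivWithinAt ℝ f S (t, y) := by
    refine (hfS (t, y) ⟨ht, hy⟩).isSymmSndFDerivWithinAt ?_ hU ?_ ⟨ht, hy⟩
    · simp only [minSmoothness_of_isRCLikeNormedField]
      exact two_le
    rw [hS, interior_prod_eq, closure_prod_eq]
    exact ⟨hD' ht, subset_closure ((extChartAt_target_isOpen (m := m) x).interior_eq.symm ▸ hy)⟩
  have hd : DifferentiableWithinAt ℝ (fderivWithin ℝ f S) S (t, y) :=
    (hfS.fderivWithin hU (m := 1) (one_add_one_eq_two.trans_le two_le)).differentiableOn (by simp)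
      (t, y) ⟨ht, hy⟩
  have key : ∀ i, HasDerivWithinAt
      (fun s => dcov (r s) ((extChartAt (𝓡 m) x).symm y) (chartFrame x y i))
      (dcov (timeD D r t) ((extChartAt (𝓡 m) x).symm y) (chartFrame x y i)) D t := by
    intro i
    have h2 : HasDerivWithinAt (fun s : ℝ => (s, y)) ((1 : ℝ), (0 : Euc m)) D t :=
      ((hasDerivAt_id t).prodMk (hasDerivAt_const t y)).hasDerivWithinAt
    have h3 := hd.hasFDerivWithinAt.comp_hasDerivWithinAt t h2 (t := S) fun s hs => ⟨hs, hy⟩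
    have h4 := h3.clm_apply (hasDerivWithinAt_const (c := ((0 : ℝ), stdVec m i)) t D)
    have e1 : dcov (timeD D r t) ((extChartAt (𝓡 m) x).symm y) (chartFrame x y i)
        = fderivWithin ℝ (fderivWithin ℝ f S) S (t, y) (1, 0) (0, stdVec m i) := by
      rw [hsymm, (hr.time_deriv hD).dcov_chartFrame ht x hy i, partialD,
        ← (hr.time_deriv hD).fderivWithin_prod_right x ht hy]
      have h5 := hd.hasFDerivWithinAt.clm_apply
        (hasFDerivWithinAt_const ((1 : ℝ), (0 : Euc m)) (t, y) S)
      have h6 := h5.congr (f₁ := fun z : ℝ × Euc m =>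
        timeD D r z.1 ((extChartAt (𝓡 m) x).symm z.2))
        (fun z hz => (hr.fderivWithin_prod_left hD x (mem_prod.1 hz).1 (mem_prod.1 hz).2).symm)
        (hr.fderivWithin_prod_left hD x ht hy).symm
      rw [h6.fderivWithin (hU _ ⟨ht, hy⟩)]
      simp
    rw [e1]
    simp only [Function.comp_def, map_zero, add_zero] at h4
    refine h4.congr (fun s hs => ?_) ?_
    · rw [hr.dcov_chartFrame hs x hy i, partialD, ← hr.fderivWithin_prod_right x hs hy]
    · rw [hr.dcov_chartFrame ht x hy i, partialD, ← hr.fderivWithin_prod_right x ht hy]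
  have hv : v = ∑ k, b.repr v k • chartFrame x y k := by
    conv_lhs => rw [← b.sum_repr v]
    simp only [hb]
  rw [hv]
  simp only [map_sum, map_smul]
  exact HasDerivWithinAt.fun_sum fun i _ => (key i).fun_const_smul _

end SmoothFamily

end Families

section MetricFamilies

variable {m : ℕ} {M : Type*} [TopologicalSpace M] [ChartedSpace (Euc m) M]
  [IsManifold (𝓡 m) ∞ M]

/-- The family `g t`, `t ∈ D`, of metrics has coefficients smooth in space and time. -/
def SmoothMetric (D : Set ℝ) (g : ℝ → Metric m M) : Prop :=
  ∀ (c : M) (i j : Fin m), ContDiffOn ℝ ∞ (fun z : ℝ × Euc m => gramInChart (g z.1) c z.2 i j)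
    (D ×ˢ (extChartAt (𝓡 m) c).target)

variable {D D' : Set ℝ} {g : ℝ → Metric m M}

theorem SmoothMetric.mono (hg : SmoothMetric D g) (h : D' ⊆ D) : SmoothMetric D' g :=
  fun c i j => (hg c i j).mono (prod_mono h Subset.rfl)

theorem SmoothMetric.contDiffOn_det (hg : SmoothMetric D g) (c : M) :
    ContDiffOn ℝ ∞ (fun z : ℝ × Euc m => (gramInChart (g z.1) c z.2).det)
      (D ×ˢ (extChartAt (𝓡 m) c).target) := by
  simp only [Matrix.det_apply']
  exact ContDiffOn.sum fun σ _ => contDiffOn_const.mul (contDiffOn_prod fun i _ => hg c _ _)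

/-- The quotient of the volume densities of two metrics of the family, squared. -/
def detRatio (g : ℝ → Metric m M) (s t : ℝ) (x : M) : ℝ := (gram (g s) x).det / (gram (g t) x).det

theorem detRatio_pos (g : ℝ → Metric m M) (s t : ℝ) (x : M) : 0 < detRatio g s t x :=
  div_pos (gram_posDef _ x).det_pos (gram_posDef _ x).det_pos

theorem detRatio_self (g : ℝ → Metric m M) (t : ℝ) (x : M) : detRatio g t t x = 1 :=
  div_self (gram_posDef _ x).det_pos.ne'

theorem SmoothMetric.detRatio (hg : SmoothMetric D g) {s : ℝ} (hs : s ∈ D) :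
    SmoothFamily (m := m) D (detRatio g s) := by
  intro c
  have h1 : ContDiffOn ℝ ∞ (fun z : ℝ × Euc m => (gramInChart (g s) c z.2).det)
      (D ×ˢ (extChartAt (𝓡 m) c).target) :=
    (hg.contDiffOn_det c).comp (f := fun z : ℝ × Euc m => (s, z.2)) (by fun_prop)
      fun z hz => ⟨hs, hz.2⟩
  refine (h1.div (hg.contDiffOn_det c) fun z hz =>
    (gramInChart_posDef (g z.1) c hz.2).det_pos.ne').congr fun z hz => ?_
  exact gram_det_div_eq (g s) (g z.1) c hz.2

/-! ### Uniform bounds on compact sets of times -/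

omit [IsManifold (𝓡 m) ∞ M] in
/-- Around every point there is a neighbourhood whose coordinates lie in a compact subset of the
target of the chart. -/
theorem exists_compact_chart_nhds (c : M) : ∃ U ∈ 𝓝 c, ∃ K : Set (Euc m), IsCompact K ∧
    K ⊆ (extChartAt (𝓡 m) c).target ∧ ∀ x ∈ U, ∃ y ∈ K, (extChartAt (𝓡 m) c).symm y = x := by
  obtain ⟨ε, hε, hsub⟩ := Metric.nhds_basis_closedBall.mem_iff.1
    ((extChartAt_target_isOpen c).mem_nhds (mem_extChartAt_target (I := 𝓡 m) c))
  refine ⟨(extChartAt (𝓡 m) c).source ∩ extChartAt (𝓡 m) c ⁻¹' Metric.closedBall _ ε,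
    inter_mem (extChartAt_source_mem_nhds c) ((continuousAt_extChartAt c).preimage_mem_nhds
      (Metric.closedBall_mem_nhds _ hε)), _, isCompact_closedBall _ _, hsub, fun x hx => ?_⟩
  exact ⟨_, hx.2, (extChartAt (𝓡 m) c).left_inv hx.1⟩

variable [CompactSpace M]

omit [ChartedSpace (Euc m) M] [IsManifold (𝓡 m) ∞ M] in
/-- Local bounds on a compact space give a global bound. -/
theorem exists_bound_of_local (P : M → ℝ → Prop) (hP : ∀ x a b, a ≤ b → P x a → P x b)
    (h : ∀ c, ∃ U ∈ 𝓝 c, ∃ C, ∀ x ∈ U, P x C) : ∃ C, 0 ≤ C ∧ ∀ x, P x C := by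
  have h1 : ∃ C, ∀ x ∈ (univ : Set M), P x C := by
    refine isCompact_univ.induction_on (p := fun s => ∃ C, ∀ x ∈ s, P x C) ⟨0, by simp⟩ ?_ ?_ ?_
    · rintro s t hst ⟨C, hC⟩
      exact ⟨C, fun x hx => hC x (hst hx)⟩
    · rintro s t ⟨C, hC⟩ ⟨C', hC'⟩
      refine ⟨max C C', fun x hx => ?_⟩
      rcases hx with hx | hx
      · exact hP _ _ _ (le_max_left _ _) (hC x hx)
      · exact hP _ _ _ (le_max_right _ _) (hC' x hx)
    · intro x _
      obtain ⟨U, hU, C, hC⟩ := h x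
      exact ⟨U, mem_nhdsWithin_of_mem_nhds hU, C, hC⟩
  obtain ⟨C, hC⟩ := h1
  exact ⟨max C 0, le_max_right _ _, fun x => hP _ _ _ (le_max_left _ _) (hC x (mem_univ x))⟩

omit [IsManifold (𝓡 m) ∞ M] in
theorem SmoothFamily.exists_bound {r : ℝ → M → ℝ} (hr : SmoothFamily (m := m) D r)
    (hD : IsCompact D) : ∃ C, 0 ≤ C ∧ ∀ t ∈ D, ∀ x, |r t x| ≤ C := by
  have := exists_bound_of_local (fun x C => ∀ t ∈ D, |r t x| ≤ C)
    (fun x a b hab h t ht => (h t ht).trans hab) fun c => ?_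
  · obtain ⟨C, hC, h⟩ := this
    exact ⟨C, hC, fun t ht x => h x t ht⟩
  · obtain ⟨U, hU, K, hK, hKs, hUK⟩ := exists_compact_chart_nhds (m := m) c
    obtain ⟨C, hC⟩ := (hD.prod hK).exists_bound_of_continuousOn
      ((hr c).continuousOn.mono (prod_mono Subset.rfl hKs))
    refine ⟨U, hU, C, fun x hx t ht => ?_⟩
    obtain ⟨y, hy, rfl⟩ := hUK x hx
    exact hC (t, y) ⟨ht, hy⟩

/-- A family of quadratic forms on `TM` with continuous coefficients is bounded, on a compact set
of times, by a multiple of each metric of a smooth family. -/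
theorem SmoothMetric.exists_quadratic_bound (hg : SmoothMetric D g) (hD : IsCompact D)
    (Q : ℝ → ∀ x : M, TangentSpace (𝓡 m) x → ℝ)
    (hQ : ∀ c : M, ∃ B : Fin m → Fin m → ℝ × Euc m → ℝ,
      (∀ i j, ContinuousOn (B i j) (D ×ˢ (extChartAt (𝓡 m) c).target)) ∧
      ∀ t ∈ D, ∀ y ∈ (extChartAt (𝓡 m) c).target, ∀ a : Fin m → ℝ,
        Q t ((extChartAt (𝓡 m) c).symm y) (∑ i, a i • chartFrame c y i)
          = ∑ i, ∑ j, a i * a j * B i j (t, y)) :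
    ∃ C, 0 ≤ C ∧ ∀ t ∈ D, ∀ s ∈ D, ∀ (x : M) (v : TangentSpace (𝓡 m) x),
      |Q t x v| ≤ C * (g s).inner x v v := by
  have := exists_bound_of_local (fun x C => ∀ t ∈ D, ∀ s ∈ D, ∀ v : TangentSpace (𝓡 m) x,
      |Q t x v| ≤ C * (g s).inner x v v)
    (fun x a b hab h t ht s hs v => (h t ht s hs v).trans
      (mul_le_mul_of_nonneg_right hab (inner_self_nonneg _ _ _))) fun c => ?_
  · obtain ⟨C, hC, h⟩ := this
    exact ⟨C, hC, fun t ht s hs x v => h x t ht s hs v⟩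
  obtain ⟨U, hU, K, hK, hKs, hUK⟩ := exists_compact_chart_nhds (m := m) c
  obtain ⟨B, hB, hQB⟩ := hQ c
  -- in coordinates, compare the two forms on the unit sphere
  let S : Set (ℝ × ℝ × Euc m × Euc m) := D ×ˢ D ×ˢ K ×ˢ Metric.sphere (0 : Euc m) 1
  have hS : IsCompact S := hD.prod (hD.prod (hK.prod (isCompact_sphere _ _)))
  let num : ℝ × ℝ × Euc m × Euc m → ℝ := fun z =>
    ∑ i, ∑ j, z.2.2.2 i * z.2.2.2 j * B i j (z.1, z.2.2.1)
  let den : ℝ × ℝ × Euc m × Euc m → ℝ := fun z =>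
    ∑ i, ∑ j, z.2.2.2 i * z.2.2.2 j * gramInChart (g z.2.1) c z.2.2.1 i j
  have hden_eq : ∀ s : ℝ, ∀ y : Euc m, ∀ a : Euc m, ∀ t : ℝ, den (t, s, y, a)
      = (g s).inner ((extChartAt (𝓡 m) c).symm y) (∑ i, a i • chartFrame c y i)
        (∑ i, a i • chartFrame c y i) := by
    intro s y a t
    rw [inner_sum_sum]
    rfl
  have hne : ∀ y ∈ K, ∀ a : Euc m, a ≠ 0 → (∑ i, a i • chartFrame c y i) ≠ 0 := by
    intro y hy a ha h0
    obtain ⟨b, hb⟩ := exists_chartBasis c (hKs hy)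
    simp only [← hb] at h0
    exact ha (by ext i; exact (Fintype.linearIndependent_iff.1 b.linearIndependent) _ h0 i)
  have hnum : ContinuousOn num S := by
    refine continuousOn_finsetSum _ fun i _ => continuousOn_finsetSum _ fun j _ => ?_
    refine ContinuousOn.mul (by fun_prop) ?_
    exact (hB i j).comp (f := fun z : ℝ × ℝ × Euc m × Euc m => (z.1, z.2.2.1)) (by fun_prop)
      fun z hz => ⟨hz.1, hKs hz.2.2.1⟩
  have hden : ContinuousOn den S := by
    refine continuousOn_finsetSum _ fun i _ => continuousOn_finsetSum _ fun j _ => ?_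
    refine ContinuousOn.mul (by fun_prop) ?_
    exact (hg c i j).continuousOn.comp (f := fun z : ℝ × ℝ × Euc m × Euc m => (z.2.1, z.2.2.1))
      (by fun_prop) fun z hz => ⟨hz.2.1, hKs hz.2.2.1⟩
  have hpos : ∀ z ∈ S, 0 < den z := by
    rintro ⟨t, s, y, a⟩ ⟨-, -, hy, ha⟩
    rw [hden_eq]
    refine (g s).pos _ _ (hne y hy a ?_)
    rintro rfl
    simp at ha
  obtain ⟨C, hC⟩ := hS.exists_bound_of_continuousOn (hnum.div hden fun z hz => (hpos z hz).ne')
  refine ⟨U, hU, C, fun x hx t ht s hs v => ?_⟩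
  obtain ⟨y, hy, rfl⟩ := hUK x hx
  obtain ⟨b, hb⟩ := exists_chartBasis c (hKs hy)
  obtain ⟨a, rfl⟩ : ∃ a : Euc m, v = ∑ i, a i • chartFrame c y i := by
    refine ⟨WithLp.toLp 2 (b.repr v), ?_⟩
    conv_lhs => rw [← b.sum_repr v]
    simp only [hb]
  rcases eq_or_ne a 0 with rfl | ha
  · have h0 := hQB t ht y (hKs hy) 0
    simp only [Pi.zero_apply, zero_smul, Finset.sum_const_zero, zero_mul] at h0
    have e0 : (∑ i, (0 : Euc m) i • chartFrame c y i) = 0 :=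
      Finset.sum_eq_zero fun i _ => zero_smul ℝ _
    rw [e0, h0, map_zero, abs_zero, mul_zero]
  · have hn : 0 < ‖a‖ := norm_pos_iff.2 ha
    have hz : (t, s, y, ‖a‖⁻¹ • a) ∈ S :=
      ⟨ht, hs, hy, by simp [norm_smul, hn.ne']⟩
    have h1 := hC _ hz
    rw [Pi.div_apply, norm_div, div_le_iff₀ (norm_pos_iff.2 (hpos _ hz).ne'), Real.norm_eq_abs,
      Real.norm_eq_abs, abs_of_pos (hpos _ hz)] at h1
    have hscale : ∀ f : Fin m → Fin m → ℝ,
        (∑ i, ∑ j, (‖a‖⁻¹ • a) i * (‖a‖⁻¹ • a) j * f i j)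
          = ‖a‖⁻¹ ^ 2 * ∑ i, ∑ j, a i * a j * f i j := by
      intro f
      simp only [Finset.mul_sum, PiLp.smul_apply, smul_eq_mul]
      refine Finset.sum_congr rfl fun i _ => Finset.sum_congr rfl fun j _ => ?_
      ring
    have e1 : num (t, s, y, ‖a‖⁻¹ • a) = _ := hscale fun i j => B i j (t, y)
    have e2 : den (t, s, y, ‖a‖⁻¹ • a) = _ := hscale fun i j => gramInChart (g s) c y i j
    rw [e1, e2, abs_mul, abs_of_pos (by positivity), mul_left_comm] at h1
    have h2 := le_of_mul_le_mul_left h1 (by positivity)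
    have h3 := hden_eq s y a t
    rw [← hQB t ht y (hKs hy)] at h2
    exact h2.trans_eq (congrArg (C * ·) h3)

/-- The metrics of a smooth family are uniformly equivalent. -/
theorem SmoothMetric.exists_equiv (hg : SmoothMetric D g) (hD : IsCompact D) :
    ∃ C, 0 ≤ C ∧ ∀ t ∈ D, ∀ s ∈ D, ∀ (x : M) (ξ : TangentSpace (𝓡 m) x →L[ℝ] ℝ),
      conorm (g s) x ξ ≤ C * conorm (g t) x ξ := by
  obtain ⟨C, hC, h⟩ := hg.exists_quadratic_bound hD (fun t x v => (g t).inner x v v) fun c =>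
    ⟨fun i j z => gramInChart (g z.1) c z.2 i j, fun i j => (hg c i j).continuousOn,
      fun t _ y _ a => by rw [inner_sum_sum]; rfl⟩
  refine ⟨Real.sqrt C, Real.sqrt_nonneg _, fun t ht s hs x ξ =>
    conorm_le_of_inner_le (g t) (g s) x ξ (Real.sqrt_nonneg _) fun v => ?_⟩
  rw [Real.sq_sqrt hC]
  exact (le_abs_self _).trans (h t ht s hs x v)

/-- The differentials of a smooth family of functions are uniformly bounded. -/
theorem SmoothMetric.exists_dcov_bound (hg : SmoothMetric D g) (hD : IsCompact D)
    {r : ℝ → M → ℝ} (hr : SmoothFamily (m := m) D r) (hU : UniqueDiffOn ℝ D) :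
    ∃ C, 0 ≤ C ∧ ∀ t ∈ D, ∀ s ∈ D, ∀ x : M, conorm (g s) x (dcov (r t) x) ≤ C := by
  obtain ⟨C, hC, h⟩ := hg.exists_quadratic_bound hD (fun t x v => dcov (r t) x v ^ 2) fun c => by
    have hcont : ∀ i : Fin m, ContinuousOn (fun z : ℝ × Euc m =>
        fderivWithin ℝ (fun z : ℝ × Euc m => r z.1 ((extChartAt (𝓡 m) c).symm z.2))
          (D ×ˢ (extChartAt (𝓡 m) c).target) z (0, stdVec m i))
        (D ×ˢ (extChartAt (𝓡 m) c).target) := fun i =>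
      (((hr c).fderivWithin (hU.prod (extChartAt_target_isOpen (m := m) c).uniqueDiffOn) (m := ∞)
        (by exact_mod_cast le_top)).continuousOn).clm_apply continuousOn_const
    refine ⟨fun i j z => _ , fun i j => (hcont i).mul (hcont j), fun t ht y hy a => ?_⟩
    simp only [map_sum, map_smul, smul_eq_mul, sq, Finset.sum_mul_sum,
      hr.dcov_chartFrame ht c hy, partialD, Pi.mul_apply]
    refine Finset.sum_congr rfl fun i _ => Finset.sum_congr rfl fun j _ => ?_
    rw [hr.fderivWithin_prod_right c ht hy, hr.fderivWithin_prod_right c ht hy]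
    ring
  refine ⟨Real.sqrt C, Real.sqrt_nonneg _, fun t ht s hs x =>
    conorm_le_of_sq_le (g s) x _ (Real.sqrt_nonneg _) fun v => ?_⟩
  rw [Real.sq_sqrt hC]
  exact (le_abs_self _).trans (h t ht s hs x v)

/-- The time derivative of a smooth family of metrics is bounded by a multiple of the metric. -/
theorem SmoothMetric.exists_deriv_bound (hg : SmoothMetric D g) (hD : IsCompact D)
    (hU : UniqueDiffOn ℝ D) (Q : ℝ → ∀ x : M, TangentSpace (𝓡 m) x → ℝ)
    (hQ : ∀ t ∈ D, ∀ (x : M) (v : TangentSpace (𝓡 m) x),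
      HasDerivWithinAt (fun s => (g s).inner x v v) (Q t x v) D t) :
    ∃ C, 0 ≤ C ∧ ∀ t ∈ D, ∀ (x : M) (v : TangentSpace (𝓡 m) x),
      |Q t x v| ≤ C * (g t).inner x v v := by
  obtain ⟨C, hC, h⟩ := hg.exists_quadratic_bound hD Q fun c => by
    have hcont : ∀ i j : Fin m, ContinuousOn (fun z : ℝ × Euc m =>
        fderivWithin ℝ (fun z : ℝ × Euc m => gramInChart (g z.1) c z.2 i j)
          (D ×ˢ (extChartAt (𝓡 m) c).target) z (1, 0))
        (D ×ˢ (extChartAt (𝓡 m) c).target) := fun i j =>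
      (((hg c i j).fderivWithin (hU.prod (extChartAt_target_isOpen (m := m) c).uniqueDiffOn)
        (m := ∞) (by exact_mod_cast le_top)).continuousOn).clm_apply continuousOn_const
    refine ⟨fun i j z => _ , hcont, fun t ht y hy a => ?_⟩
    have h1 : HasDerivWithinAt (fun s => ∑ i, ∑ j, a i * a j * gramInChart (g s) c y i j)
        (Q t ((extChartAt (𝓡 m) c).symm y) (∑ i, a i • chartFrame c y i)) D t := by
      refine (hQ t ht _ (∑ i, a i • chartFrame c y i)).congr_of_eventuallyEq
        (Eventually.of_forall fun s => ?_) ?_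
      · exact (inner_sum_sum (g s) _ (chartFrame c y) a a).symm
      · exact (inner_sum_sum (g t) _ (chartFrame c y) a a).symm
    have h2 : HasDerivWithinAt (fun s => ∑ i, ∑ j, a i * a j * gramInChart (g s) c y i j)
        (∑ i, ∑ j, a i * a j * fderivWithin ℝ
          (fun z : ℝ × Euc m => gramInChart (g z.1) c z.2 i j)
          (D ×ˢ (extChartAt (𝓡 m) c).target) (t, y) (1, 0)) D t := by
      refine HasDerivWithinAt.fun_sum fun i _ => HasDerivWithinAt.fun_sum fun j _ =>
        HasDerivWithinAt.const_mul _ ?_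
      have h1 := ((hg c i j).differentiableOn (by simp) (t, y) ⟨ht, hy⟩).hasFDerivWithinAt
      have h2 : HasDerivWithinAt (fun s : ℝ => (s, y)) ((1 : ℝ), (0 : Euc m)) D t :=
        ((hasDerivAt_id t).prodMk (hasDerivAt_const t y)).hasDerivWithinAt
      exact h1.comp_hasDerivWithinAt t h2 (t := D ×ˢ (extChartAt (𝓡 m) c).target)
        fun s hs => ⟨hs, hy⟩
    exact (hU t ht).eq_deriv _ h1 h2
  exact ⟨C, hC, fun t ht x v => h t ht t ht x v⟩

end MetricFamilies

section Volume

variable {m : ℕ} {M : Type*} [TopologicalSpace M] [ChartedSpace (Euc m) M]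
  [IsManifold (𝓡 m) ∞ M] {D : Set ℝ} {g : ℝ → Metric m M}

/-! ### The Riemannian measure -/

variable [MeasurableSpace M] [BorelSpace M]

omit [IsManifold (𝓡 m) ∞ M] in
theorem aemeasurable_extChartAt_symm (c : M) :
    AEMeasurable (extChartAt (𝓡 m) c).symm (volume.restrict (extChartAt (𝓡 m) c).target) :=
  (continuousOn_extChartAt_symm c).aemeasurable (extChartAt_target_isOpen c).measurableSet

omit [IsManifold (𝓡 m) ∞ M] in
/-- A chart extended to a measurable map on `M`. -/
theorem exists_measurable_chart (c : M) : ∃ e : M → Euc m, Measurable e ∧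
    ∀ y ∈ (extChartAt (𝓡 m) c).target, e ((extChartAt (𝓡 m) c).symm y) = y := by
  classical
  refine ⟨(extChartAt (𝓡 m) c).source.piecewise (extChartAt (𝓡 m) c) (fun _ => 0),
    (continuousOn_extChartAt c).measurable_piecewise continuousOn_const
      (isOpen_extChartAt_source c).measurableSet, fun y hy => ?_⟩
  rw [piecewise_eq_of_mem _ _ _ ((extChartAt (𝓡 m) c).map_target hy),
    (extChartAt (𝓡 m) c).right_inv hy]

omit [MeasurableSpace M] [BorelSpace M] in
theorem SmoothMetric.aemeasurable_det (hg : SmoothMetric D g) {t : ℝ} (ht : t ∈ D) (c : M) :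
    AEMeasurable (fun y => ENNReal.ofReal (Real.sqrt (gramInChart (g t) c y).det))
      (volume.restrict (extChartAt (𝓡 m) c).target) := by
  have h : ContinuousOn (fun y => (gramInChart (g t) c y).det) (extChartAt (𝓡 m) c).target :=
    (hg.contDiffOn_det c).continuousOn.comp (f := fun y : Euc m => (t, y)) (by fun_prop)
      fun y hy => ⟨ht, hy⟩
  exact ((h.aemeasurable (extChartAt_target_isOpen c).measurableSet).sqrt).ennreal_ofReal

theorem SmoothMetric.lintegral_chartVolume (hg : SmoothMetric D g) {t : ℝ} (ht : t ∈ D) (c : M)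
    {F : M → ENNReal} (hF : Measurable F) :
    ∫⁻ x, F x ∂(chartVolume (g t) c) = ∫⁻ y in (extChartAt (𝓡 m) c).target,
      ENNReal.ofReal (Real.sqrt (gramInChart (g t) c y).det)
        * F ((extChartAt (𝓡 m) c).symm y) := by
  have h1 := aemeasurable_extChartAt_symm (m := m) c
  rw [chartVolume, lintegral_map' hF.aemeasurable
    (h1.mono_ac (withDensity_absolutelyContinuous _ _)),
    lintegral_withDensity_eq_lintegral_mul₀ (hg.aemeasurable_det ht c)
      (g := fun y => F ((extChartAt (𝓡 m) c).symm y)) (hF.comp_aemeasurable h1)]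
  rfl

/-- The density of one Riemannian measure with respect to another one. -/
def density (g : ℝ → Metric m M) (s t : ℝ) (x : M) : ℝ := Real.sqrt (detRatio g t s x)

omit [MeasurableSpace M] [BorelSpace M] in
theorem density_pos (g : ℝ → Metric m M) (s t : ℝ) (x : M) : 0 < density g s t x :=
  Real.sqrt_pos.2 (detRatio_pos g t s x)

omit [MeasurableSpace M] [BorelSpace M] in
theorem SmoothMetric.density (hg : SmoothMetric D g) {s : ℝ} (hs : s ∈ D) :
    SmoothFamily (m := m) D (density g s) := by
  refine (((hg.detRatio hs).inv fun t _ x => (detRatio_pos g s t x).ne').rpow_const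
    (fun t _ x => inv_ne_zero (detRatio_pos g s t x).ne') (1 / 2)).congr fun t _ x => ?_
  rw [RHFlow.density, Real.sqrt_eq_rpow, RHFlow.detRatio, RHFlow.detRatio, inv_div]

theorem SmoothMetric.chartVolume_eq (hg : SmoothMetric D g) {s t : ℝ} (hs : s ∈ D) (ht : t ∈ D)
    (c : M) : chartVolume (g t) c
      = (chartVolume (g s) c).withDensity fun x => ENNReal.ofReal (RHFlow.density g s t x) := by
  have hm : Measurable fun x => ENNReal.ofReal (RHFlow.density g s t x) :=
    ((hg.density hs).continuous ht).measurable.ennreal_ofReal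
  ext A hA
  rw [← lintegral_indicator_one hA, ← lintegral_indicator_one hA,
    lintegral_withDensity_eq_lintegral_mul _ hm (measurable_one.indicator hA),
    hg.lintegral_chartVolume ht c (measurable_one.indicator hA),
    hg.lintegral_chartVolume hs c (hm.mul (measurable_one.indicator hA))]
  refine setLIntegral_congr_fun (extChartAt_target_isOpen c).measurableSet fun y hy => ?_
  simp only [Pi.mul_apply]
  rw [← mul_assoc, ← ENNReal.ofReal_mul (Real.sqrt_nonneg _)]
  congr 2
  rw [RHFlow.density, RHFlow.detRatio, gram_det_div_eq _ _ c hy,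
    ← Real.sqrt_mul (gramInChart_posDef (g s) c hy).det_pos.le, mul_div_cancel₀]
  exact (gramInChart_posDef (g s) c hy).det_pos.ne'

variable [CompactSpace M]

open Classical in
omit [IsManifold (𝓡 m) ∞ M] in
theorem measurable_chartWeight : Measurable fun x : M =>
    (((chartCover m M).filter fun d => x ∈ (extChartAt (𝓡 m) d).source).card : ENNReal)⁻¹ := by
  refine Measurable.inv ?_
  simp only [Finset.card_filter, Nat.cast_sum]
  refine Finset.measurable_sum _ fun d _ => ?_
  simp only [Nat.cast_ite, Nat.cast_one, Nat.cast_zero]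
  exact Measurable.ite (isOpen_extChartAt_source (I := 𝓡 m) d).measurableSet measurable_const
    measurable_const

/-- The Riemannian measures of a smooth family are related by the quotients of the volume
densities. -/
theorem SmoothMetric.riemannianVolume_eq (hg : SmoothMetric D g) {s t : ℝ} (hs : s ∈ D)
    (ht : t ∈ D) : riemannianVolume (g t)
      = (riemannianVolume (g s)).withDensity fun x => ENNReal.ofReal (RHFlow.density g s t x) := by
  classical
  have hm : Measurable fun x => ENNReal.ofReal (RHFlow.density g s t x) :=
    ((hg.density hs).continuous ht).measurable.ennreal_ofReal
  have hw := measurable_chartWeight (m := m) (M := M)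
  ext A hA
  rw [withDensity_apply _ hA, ← lintegral_indicator hA]
  simp only [riemannianVolume]
  rw [lintegral_finsetSum_measure, Measure.finsetSum_apply]
  refine Finset.sum_congr rfl fun c _ => ?_
  rw [lintegral_withDensity_eq_lintegral_mul _ hw (hm.indicator hA), withDensity_apply _ hA,
    ← lintegral_indicator hA, hg.chartVolume_eq hs ht c,
    lintegral_withDensity_eq_lintegral_mul _ hm (hw.indicator hA)]
  refine lintegral_congr fun x => ?_
  by_cases hx : x ∈ A
  · simp only [Pi.mul_apply, indicator_of_mem hx]
    exact mul_comm _ _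
  · simp only [Pi.mul_apply, indicator_of_notMem hx, mul_zero]

theorem SmoothMetric.integral_eq (hg : SmoothMetric D g) {s t : ℝ} (hs : s ∈ D) (ht : t ∈ D)
    (f : M → ℝ) : ∫ x, f x ∂(riemannianVolume (g t))
      = ∫ x, f x * RHFlow.density g s t x ∂(riemannianVolume (g s)) := by
  rw [hg.riemannianVolume_eq hs ht, integral_withDensity_eq_integral_toReal_smul
    ((hg.density hs).continuous ht).measurable.ennreal_ofReal
    (Eventually.of_forall fun _ => ENNReal.ofReal_lt_top)]
  refine integral_congr_ae (Eventually.of_forall fun x => ?_)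
  simp only [ENNReal.toReal_ofReal (density_pos g s t x).le, smul_eq_mul]
  exact mul_comm _ _

theorem SmoothMetric.memLp (hg : SmoothMetric D g) {s t : ℝ} (hs : s ∈ D)
    (ht : t ∈ D) {f : M → ℝ} {p : ENNReal} (hf : MemLp f p (riemannianVolume (g s))) :
    MemLp f p (riemannianVolume (g t)) := by
  obtain ⟨C, hC, h⟩ := ((hg.density hs).mono (singleton_subset_iff.2 ht)).exists_bound
    isCompact_singleton
  refine hf.of_measure_le_smul (c := ENNReal.ofReal C) ENNReal.ofReal_ne_top ?_
  rw [hg.riemannianVolume_eq hs ht, ← withDensity_const]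
  exact withDensity_mono (Eventually.of_forall fun x => ENNReal.ofReal_le_ofReal
    ((le_abs_self _).trans (h t rfl x)))

omit [CompactSpace M] in
theorem ae_chartVolume_of_ae (g : Metric m M) {P : M → Prop} (c : M)
    (h1 : ∀ᵐ y ∂(volume.restrict (extChartAt (𝓡 m) c).target),
      P ((extChartAt (𝓡 m) c).symm y)) : ∀ᵐ x ∂(chartVolume g c), P x := by
  obtain ⟨e, he, heq⟩ := exists_measurable_chart (m := m) c
  -- cover the exceptional set by a measurable set
  obtain ⟨N, hN, hNm, hN0⟩ := exists_measurable_superset_of_null h1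
  have hA : MeasurableSet ((extChartAt (𝓡 m) c).sourceᶜ ∪ e ⁻¹' N) :=
    (isOpen_extChartAt_source c).measurableSet.compl.union (he hNm)
  refine measure_mono_null (t := (extChartAt (𝓡 m) c).sourceᶜ ∪ e ⁻¹' N) ?_ ?_
  · intro x hx
    by_cases hs : x ∈ (extChartAt (𝓡 m) c).source
    · right
      have h2 : (extChartAt (𝓡 m) c).symm (extChartAt (𝓡 m) c x) = x :=
        (extChartAt (𝓡 m) c).left_inv hs
      have h3 := heq _ ((extChartAt (𝓡 m) c).map_source hs)
      rw [h2] at h3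
      rw [mem_preimage, h3]
      refine hN ?_
      simpa only [mem_compl_iff, mem_ofPred_eq, h2] using hx
    · exact Or.inl hs
  · have hsymm : AEMeasurable (extChartAt (𝓡 m) c).symm
        ((volume.restrict (extChartAt (𝓡 m) c).target).withDensity
          (fun y => ENNReal.ofReal (Real.sqrt (gramInChart g c y).det))) :=
      (aemeasurable_extChartAt_symm c).mono_ac (withDensity_absolutelyContinuous _ _)
    rw [chartVolume, Measure.map_apply_of_aemeasurable hsymm hA]
    refine withDensity_absolutelyContinuous _ _ ?_
    have h4 : ∀ᵐ y ∂(volume.restrict (extChartAt (𝓡 m) c).target),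
        y ∈ (extChartAt (𝓡 m) c).target ∧ y ∉ N :=
      (ae_restrict_mem (extChartAt_target_isOpen c).measurableSet).and
        (measure_eq_zero_iff_ae_notMem.1 hN0)
    refine measure_mono_null (fun y hy => ?_) h4
    rintro ⟨hy1, hy2⟩
    rcases hy with hy | hy
    · exact hy ((extChartAt (𝓡 m) c).map_target hy1)
    · rw [mem_preimage, heq y hy1] at hy
      exact hy2 hy

/-- A property which holds almost everywhere in every chart holds almost everywhere. -/
theorem ae_of_ae_chart (g : Metric m M) {P : M → Prop}
    (h : ∀ c : M, ∀ᵐ y ∂(volume.restrict (extChartAt (𝓡 m) c).target),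
      P ((extChartAt (𝓡 m) c).symm y)) : ∀ᵐ x ∂(riemannianVolume g), P x := by
  simp only [riemannianVolume, ae_finsetSum_measure_iff]
  exact fun c _ => (withDensity_absolutelyContinuous _ _).ae_le (ae_chartVolume_of_ae g c (h c))

/-- A function which is measurable in every chart is measurable. -/
theorem aestronglyMeasurable_of_chart (g : Metric m M) {f : M → ℝ}
    (h : ∀ c : M, AEStronglyMeasurable (fun y => f ((extChartAt (𝓡 m) c).symm y))
      (volume.restrict (extChartAt (𝓡 m) c).target)) :
    AEStronglyMeasurable f (riemannianVolume g) := by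
  have hc : ∀ c : M, AEStronglyMeasurable f (chartVolume g c) := by
    intro c
    obtain ⟨e, he, heq⟩ := exists_measurable_chart (m := m) c
    obtain ⟨f', hf', hff'⟩ := h c
    refine ⟨fun x => f' (e x), hf'.comp_measurable he, ae_chartVolume_of_ae g c ?_⟩
    filter_upwards [hff', ae_restrict_mem (extChartAt_target_isOpen c).measurableSet] with y h1 h2
    rw [heq y h2, h1]
  simp only [riemannianVolume]
  refine Finset.sum_induction _ (fun μ => AEStronglyMeasurable f μ)
    (fun μ ν h1 h2 => aestronglyMeasurable_add_measure_iff.2 ⟨h1, h2⟩)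
    (aestronglyMeasurable_zero_measure f) fun c _ => ?_
  exact (hc c).mono_ac (withDensity_absolutelyContinuous _ _)

end Volume

/-! ### Weak differentials -/

theorem integrableOn_mul_test {E : Type*} [NormedAddCommGroup E] [MeasurableSpace E]
    [OpensMeasurableSpace E] {μ : Measure E} {U : Set E} (hU : IsOpen U)
    {f χ : E → ℝ} (hf : LocallyIntegrableOn f U μ) (hχ : ContinuousOn χ U)
    {ψ : E → ℝ} (hψ : HasCompactSupport ψ) (hψU : tsupport ψ ⊆ U)
    (h0 : ∀ y, y ∉ tsupport ψ → χ y = 0) : IntegrableOn (fun y => f y * χ y) U μ := by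
  have h1 : IntegrableOn (fun y => f y * χ y) (tsupport ψ) μ :=
    (hf.integrableOn_compact_subset hψU hψ).mul_continuousOn (hχ.mono hψU) hψ
  refine h1.of_forall_sdiff_eq_zero hU.measurableSet fun y hy => ?_
  rw [h0 y hy.2, mul_zero]

theorem contDiff_mul_test {E : Type*} [NormedAddCommGroup E] [NormedSpace ℝ E] {U : Set E}
    (hU : IsOpen U) {b ψ : E → ℝ} (hb : ContDiffOn ℝ ∞ b U) (hψ : ContDiff ℝ ∞ ψ)
    (hψU : tsupport ψ ⊆ U) : ContDiff ℝ ∞ (fun y => b y * ψ y) := by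
  rw [contDiff_iff_contDiffAt]
  intro y
  by_cases hy : y ∈ U
  · exact (hb.contDiffAt (hU.mem_nhds hy)).mul hψ.contDiffAt
  · have hy' : y ∉ tsupport ψ := fun h => hy (hψU h)
    have h0 : (fun y => b y * ψ y) =ᶠ[𝓝 y] fun _ => 0 := by
      filter_upwards [(isClosed_tsupport ψ).isOpen_compl.mem_nhds hy'] with z hz
      rw [image_eq_zero_of_notMem_tsupport hz, mul_zero]
    exact contDiffAt_const.congr_of_eventuallyEq h0

section WeakDifferential

variable {m : ℕ} {M : Type*} [TopologicalSpace M] [ChartedSpace (Euc m) M]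
  [IsManifold (𝓡 m) ∞ M] {u : M → ℝ} {ξ η : ∀ x : M, TangentSpace (𝓡 m) x →L[ℝ] ℝ}

omit [IsManifold (𝓡 m) ∞ M] in
theorem isWeakDifferential_weakDifferential (h : IsWeakDifferential u ξ) :
    IsWeakDifferential u (weakDifferential u : ∀ x : M, TangentSpace (𝓡 m) x →L[ℝ] ℝ) := by
  have h' : ∃ ξ : ∀ x : M, TangentSpace (𝓡 m) x →L[ℝ] ℝ, IsWeakDifferential u ξ := ⟨ξ, h⟩
  rw [weakDifferential, dif_pos h']
  exact h'.choose_spec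

theorem clm_ext_chartFrame (c : M) {y : Euc m} (hy : y ∈ (extChartAt (𝓡 m) c).target)
    {ξ η : TangentSpace (𝓡 m) ((extChartAt (𝓡 m) c).symm y) →L[ℝ] ℝ}
    (h : ∀ i, ξ (chartFrame c y i) = η (chartFrame c y i)) : ξ = η := by
  obtain ⟨b, hb⟩ := exists_chartBasis c hy
  have h1 : (ξ : TangentSpace (𝓡 m) ((extChartAt (𝓡 m) c).symm y) →ₗ[ℝ] ℝ) = η :=
    b.ext fun i => by rw [hb]; exact h i
  ext v
  exact congrArg (fun L : TangentSpace (𝓡 m) ((extChartAt (𝓡 m) c).symm y) →ₗ[ℝ] ℝ => L v) h1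

/-- The weak differential is unique up to null sets. -/
theorem IsWeakDifferential.ae_chart_eq (hξ : IsWeakDifferential u ξ)
    (hη : IsWeakDifferential u η) (c : M) :
    ∀ᵐ y ∂(volume.restrict (extChartAt (𝓡 m) c).target),
      ξ ((extChartAt (𝓡 m) c).symm y) = η ((extChartAt (𝓡 m) c).symm y) := by
  have hU := extChartAt_target_isOpen (m := m) c
  have key : ∀ i : Fin m, ∀ᵐ y ∂(volume : Measure (Euc m)), y ∈ (extChartAt (𝓡 m) c).target →
      ξ ((extChartAt (𝓡 m) c).symm y) (chartFrame c y i)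
        - η ((extChartAt (𝓡 m) c).symm y) (chartFrame c y i) = 0 := by
    intro i
    obtain ⟨h1, h2⟩ := (hξ c).2 i
    obtain ⟨h3, h4⟩ := (hη c).2 i
    refine hU.ae_eq_zero_of_integral_contDiff_smul_eq_zero (h1.sub h3) fun ψ hψ hc hs => ?_
    have e1 := integrableOn_mul_test hU h1 hψ.continuous.continuousOn hc hs
      fun y hy => image_eq_zero_of_notMem_tsupport hy
    have e2 := integrableOn_mul_test hU h3 hψ.continuous.continuousOn hc hs
      fun y hy => image_eq_zero_of_notMem_tsupport hy
    have e3 := (h2 ψ hψ hc hs).symm.trans (h4 ψ hψ hc hs)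
    rw [← setIntegral_eq_integral_of_forall_compl_eq_zero
      (s := (extChartAt (𝓡 m) c).target) fun y hy => by
        rw [image_eq_zero_of_notMem_tsupport fun h => hy (hs h), zero_smul]]
    have e4 := integral_sub e1 e2
    rw [neg_inj.1 e3, sub_self] at e4
    rw [← e4]
    refine integral_congr_ae (Eventually.of_forall fun y => ?_)
    simp only [smul_eq_mul]
    ring
  rw [← ae_all_iff] at key
  rw [ae_restrict_iff' hU.measurableSet]
  filter_upwards [key] with y hy hyU
  exact clm_ext_chartFrame c hyU fun i => sub_eq_zero.1 (hy i hyU)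

/-- The product rule for a smooth function and a weakly differentiable function. -/
theorem IsWeakDifferential.smooth_mul (hξ : IsWeakDifferential u ξ) {D : Set ℝ} {r : ℝ → M → ℝ}
    (hr : SmoothFamily (m := m) D r) {t : ℝ} (ht : t ∈ D) :
    IsWeakDifferential (fun x => r t x * u x) fun x => r t x • ξ x + u x • dcov (r t) x := by
  intro c
  have hU := extChartAt_target_isOpen (m := m) c
  obtain ⟨hu, hw⟩ := hξ c
  have hb := hr.contDiffOn_chart ht c
  set b : Euc m → ℝ := fun y => r t ((extChartAt (𝓡 m) c).symm y) with hbdef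
  have hbi : ∀ i : Fin m, ContinuousOn (fun y => partialD i b y) (extChartAt (𝓡 m) c).target :=
    fun i => (hb.continuousOn_fderiv_of_isOpen hU (by simp)).clm_apply continuousOn_const
  have heq : ∀ i : Fin m, EqOn
      (fun y => b y * ξ ((extChartAt (𝓡 m) c).symm y) (chartFrame c y i)
        + partialD i b y * u ((extChartAt (𝓡 m) c).symm y))
      (fun y => (r t ((extChartAt (𝓡 m) c).symm y) • ξ ((extChartAt (𝓡 m) c).symm y)
        + u ((extChartAt (𝓡 m) c).symm y) • dcov (r t) ((extChartAt (𝓡 m) c).symm y) :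
          TangentSpace (𝓡 m) ((extChartAt (𝓡 m) c).symm y) →L[ℝ] ℝ)
          (chartFrame c y i)) (extChartAt (𝓡 m) c).target := by
    intro i y hy
    change b y * ξ ((extChartAt (𝓡 m) c).symm y) (chartFrame c y i)
        + partialD i b y * u ((extChartAt (𝓡 m) c).symm y)
      = b y * ξ ((extChartAt (𝓡 m) c).symm y) (chartFrame c y i)
        + u ((extChartAt (𝓡 m) c).symm y)
          * dcov (r t) ((extChartAt (𝓡 m) c).symm y) (chartFrame c y i)
    rw [hr.dcov_chartFrame ht c hy i]
    ring
  refine ⟨hu.continuousOn_mul hb.continuousOn hU.isLocallyClosed, fun i => ⟨?_, ?_⟩⟩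
  · have h1 := ((hw i).1.continuousOn_mul hb.continuousOn hU.isLocallyClosed).add
      (hu.continuousOn_mul (hbi i) hU.isLocallyClosed)
    rw [locallyIntegrableOn_iff hU.isLocallyClosed] at h1 ⊢
    exact fun k hk hkc => (h1 k hk hkc).congr_fun ((heq i).mono hk) hkc.measurableSet
  · intro ψ hψ hc hs
    have h1 := (hw i).2 (fun y => b y * ψ y) (contDiff_mul_test hU hb hψ hs) hc.mul_left
      ((tsupport_mul_subset_right).trans hs)
    have hψ0 : ∀ y, y ∉ tsupport ψ → ψ y = 0 := fun y hy => image_eq_zero_of_notMem_tsupport hy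
    have hdψ : Continuous (fun y => partialD i ψ y) :=
      (hψ.continuous_fderiv (by simp)).clm_apply continuous_const
    have hdψ0 : ∀ y, y ∉ tsupport ψ → partialD i ψ y = 0 := fun y hy => by
      have : fderiv ℝ ψ y = 0 := by
        by_contra h
        exact hy (support_fderiv_subset ℝ h)
      rw [partialD, this]; rfl
    have hprod : EqOn (fun y => u ((extChartAt (𝓡 m) c).symm y) * partialD i (fun y => b y * ψ y) y)
        (fun y => u ((extChartAt (𝓡 m) c).symm y) * (b y * partialD i ψ y)
          + u ((extChartAt (𝓡 m) c).symm y) * (partialD i b y * ψ y))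
        (extChartAt (𝓡 m) c).target := by
      intro y hy
      have hd : DifferentiableAt ℝ b y :=
        (hb.contDiffAt (hU.mem_nhds hy)).differentiableAt (by simp)
      simp only [partialD, fderiv_fun_mul hd (hψ.differentiable (by simp) y)]
      simp only [FunLike.coe_add, FunLike.coe_smul, Pi.add_apply,
        Pi.smul_apply, smul_eq_mul]
      ring
    have i1 := integrableOn_mul_test hU hu (hb.continuousOn.mul hdψ.continuousOn) hc hs
      fun y hy => by simp only [Pi.mul_apply, hdψ0 y hy, mul_zero]
    have i2 := integrableOn_mul_test hU hu ((hbi i).mul hψ.continuous.continuousOn) hc hs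
      fun y hy => by simp only [Pi.mul_apply, hψ0 y hy, mul_zero]
    have i3 := integrableOn_mul_test hU (hw i).1 (hb.continuousOn.mul hψ.continuous.continuousOn)
      hc hs fun y hy => by simp only [Pi.mul_apply, hψ0 y hy, mul_zero]
    rw [setIntegral_congr_fun hU.measurableSet hprod] at h1
    have h2 := integral_add i1 i2
    have h3 := integral_add i3 i2
    simp only [Pi.mul_apply] at h2 h3
    rw [h2] at h1
    have e1 : ∫ y in (extChartAt (𝓡 m) c).target,
        r t ((extChartAt (𝓡 m) c).symm y) * u ((extChartAt (𝓡 m) c).symm y) * partialD i ψ y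
        = ∫ y in (extChartAt (𝓡 m) c).target,
          u ((extChartAt (𝓡 m) c).symm y) * (b y * partialD i ψ y) :=
      integral_congr_ae (Eventually.of_forall fun y => by simp only [hbdef]; ring)
    rw [e1, eq_sub_of_add_eq h1]
    have e2 := setIntegral_congr_fun (μ := volume) hU.measurableSet fun y hy =>
      congrArg (· * ψ y) (heq i hy)
    have e3 : ∫ y in (extChartAt (𝓡 m) c).target,
        (b y * ξ ((extChartAt (𝓡 m) c).symm y) (chartFrame c y i)
          + partialD i b y * u ((extChartAt (𝓡 m) c).symm y)) * ψ y
        = ∫ y in (extChartAt (𝓡 m) c).target,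
          ξ ((extChartAt (𝓡 m) c).symm y) (chartFrame c y i) * (b y * ψ y)
          + u ((extChartAt (𝓡 m) c).symm y) * (partialD i b y * ψ y) :=
      integral_congr_ae (Eventually.of_forall fun y => by simp only; ring)
    rw [← e2, e3, h3]
    ring

variable {D : Set ℝ} {g : ℝ → Metric m M}

/-- The norm of a weak differential is measurable in every chart. -/
theorem SmoothMetric.aestronglyMeasurable_conorm_chart (hg : SmoothMetric D g) {t : ℝ}
    (ht : t ∈ D) (hξ : IsWeakDifferential u ξ) (c : M) :
    AEStronglyMeasurable (fun y => conorm (g t) ((extChartAt (𝓡 m) c).symm y)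
      (ξ ((extChartAt (𝓡 m) c).symm y))) (volume.restrict (extChartAt (𝓡 m) c).target) := by
  have hU := extChartAt_target_isOpen (m := m) c
  have hinv : ∀ i j, AEStronglyMeasurable (fun y => (gramInChart (g t) c y)⁻¹ i j)
      (volume.restrict (extChartAt (𝓡 m) c).target) := by
    intro i j
    refine ContinuousOn.aestronglyMeasurable (fun y hy => ContinuousAt.continuousWithinAt ?_)
      hU.measurableSet
    have h1 : ContinuousAt (fun y => gramInChart (g t) c y) y := by
      refine continuousAt_pi.2 fun k => continuousAt_pi.2 fun l => ?_
      exact ((hg c k l).continuousOn.comp (f := fun y : Euc m => (t, y)) (by fun_prop)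
        fun y hy => ⟨ht, hy⟩).continuousAt (hU.mem_nhds hy)
    have hdet := (gramInChart_posDef (g t) c hy).det_pos.ne'
    have h2 : ContinuousAt (fun y => (gramInChart (g t) c y)⁻¹) y :=
      ContinuousAt.comp (f := fun y => gramInChart (g t) c y) (g := Inv.inv)
        (continuousAt_matrix_inv _ (by
          rw [show (Ring.inverse : ℝ → ℝ) = Inv.inv from funext fun a => Ring.inverse_eq_inv a]
          exact continuousAt_inv₀ hdet)) h1
    exact continuousAt_pi.1 (continuousAt_pi.1 h2 i) j
  have h1 : AEStronglyMeasurable (fun y => ∑ i, ∑ j, (gramInChart (g t) c y)⁻¹ i j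
      * ξ ((extChartAt (𝓡 m) c).symm y) (chartFrame c y j)
      * ξ ((extChartAt (𝓡 m) c).symm y) (chartFrame c y i))
      (volume.restrict (extChartAt (𝓡 m) c).target) := by
    have hξm : ∀ i, AEStronglyMeasurable
        (fun y => ξ ((extChartAt (𝓡 m) c).symm y) (chartFrame c y i))
        (volume.restrict (extChartAt (𝓡 m) c).target) :=
      fun i => ((hξ c).2 i).1.aestronglyMeasurable
    exact Finset.aestronglyMeasurable_fun_sum _ fun i _ =>
      Finset.aestronglyMeasurable_fun_sum _ fun j _ => ((hinv i j).mul (hξm j)).mul (hξm i)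
  refine (Real.continuous_sqrt.comp_aestronglyMeasurable h1).congr ?_
  rw [EventuallyEq, ae_restrict_iff' hU.measurableSet]
  refine Eventually.of_forall fun y hy => ?_
  obtain ⟨b, hb⟩ := exists_chartBasis c hy
  rw [← Real.sqrt_sq (conorm_nonneg (g t) _ (ξ ((extChartAt (𝓡 m) c).symm y))),
    conorm_sq_eq_sum _ _ b, ← gramInChart_eq_gramOf _ c hb]
  exact congrArg Real.sqrt (Finset.sum_congr rfl fun i _ => Finset.sum_congr rfl fun j _ => by
    rw [hb, hb])

variable [CompactSpace M] [MeasurableSpace M] [BorelSpace M]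

theorem IsWeakDifferential.ae_eq (hξ : IsWeakDifferential u ξ) (hη : IsWeakDifferential u η)
    (g : Metric m M) : ∀ᵐ x ∂(riemannianVolume g), ξ x = η x :=
  ae_of_ae_chart g (hξ.ae_chart_eq hη)

theorem SmoothMetric.aestronglyMeasurable_conorm (hg : SmoothMetric D g) {t : ℝ}
    (ht : t ∈ D) (hξ : IsWeakDifferential u ξ) (s : ℝ) :
    AEStronglyMeasurable (fun x => conorm (g t) x (ξ x)) (riemannianVolume (g s)) :=
  aestronglyMeasurable_of_chart _ (hg.aestronglyMeasurable_conorm_chart ht hξ)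

end WeakDifferential

/-! ### Differentiation under the integral sign -/

/-- Differentiation under the integral sign, for one-sided derivatives at end points too. -/
theorem hasDerivWithinAt_integral_of_dominated {X : Type*} [MeasurableSpace X] {μ : Measure X}
    {J : Set ℝ} (hJ : Convex ℝ J) (hU : UniqueDiffOn ℝ J) {F F' : ℝ → X → ℝ} {bound : X → ℝ}
    (hbound : Integrable bound μ) (hF : ∀ t ∈ J, Integrable (F t) μ)
    (hF' : ∀ᵐ x ∂μ, ∀ t ∈ J, HasDerivWithinAt (fun s => F s x) (F' t x) J t ∧ |F' t x| ≤ bound x)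
    {t : ℝ} (ht : t ∈ J) :
    Integrable (F' t) μ ∧ HasDerivWithinAt (fun s => ∫ x, F s x ∂μ) (∫ x, F' t x ∂μ) J t := by
  classical
  have hne : (𝓝[J \ {t}] t).NeBot :=
    accPt_principal_iff_nhdsWithin.1 (uniqueDiffWithinAt_iff_accPt.1 (hU t ht))
  -- difference quotients, extended by zero to all times
  let q : ℝ → X → ℝ := fun s x =>
    ((if s ∈ J then s else t) - t)⁻¹ * (F (if s ∈ J then s else t) x - F t x)
  have hmem : ∀ s : ℝ, (if s ∈ J then s else t) ∈ J := fun s => by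
    split_ifs with h
    · exact h
    · exact ht
  have hqm : ∀ s, AEStronglyMeasurable (q s) μ := fun s =>
    (((hF _ (hmem s)).sub (hF t ht)).const_mul _).aestronglyMeasurable
  have hqlim : ∀ᵐ x ∂μ, Tendsto (fun s => q s x) (𝓝[J \ {t}] t) (𝓝 (F' t x)) := by
    filter_upwards [hF'] with x hx
    refine ((hasDerivWithinAt_iff_tendsto_slope.1 (hx t ht).1).congr' ?_)
    filter_upwards [self_mem_nhdsWithin] with s hs
    simp only [q, if_pos hs.1, slope_def_field, div_eq_inv_mul]
  have hqb : ∀ s, ∀ᵐ x ∂μ, ‖q s x‖ ≤ bound x := by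
    intro s
    filter_upwards [hF'] with x hx
    have h1 := hJ.norm_image_sub_le_of_norm_hasDerivWithin_le (fun r hr => (hx r hr).1)
      (fun r hr => by rw [Real.norm_eq_abs]; exact (hx r hr).2) ht (hmem s)
    have hb0 : 0 ≤ bound x := (abs_nonneg _).trans (hx t ht).2
    simp only [q, norm_mul, norm_inv]
    refine inv_mul_le_of_le_mul₀ (norm_nonneg _) hb0 (h1.trans_eq (mul_comm _ _))
  have hm' : AEStronglyMeasurable (F' t) μ :=
    aestronglyMeasurable_of_tendsto_ae _ hqm hqlim
  refine ⟨hbound.mono' hm' ?_, ?_⟩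
  · filter_upwards [hF'] with x hx
    exact (hx t ht).2
  · rw [hasDerivWithinAt_iff_tendsto_slope]
    refine (tendsto_integral_filter_of_dominated_convergence bound
      (Eventually.of_forall hqm) (Eventually.of_forall hqb) hbound hqlim).congr' ?_
    filter_upwards [self_mem_nhdsWithin] with s hs
    simp only [q, if_pos hs.1, slope_def_field, div_eq_inv_mul]
    rw [integral_const_mul, integral_sub (hF s hs.1) (hF t ht)]

section

variable {m : ℕ} {M : Type*} [TopologicalSpace M] [ChartedSpace (Euc m) M]
  [IsManifold (𝓡 m) ∞ M] [CompactSpace M] [MeasurableSpace M] [BorelSpace M]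

theorem SmoothFamily.integrable_mul {D : Set ℝ} (hD : IsCompact D) {Q : ℝ → M → ℝ}
    (hQ : SmoothFamily (m := m) D Q) {μ : Measure M} {w : M → ℝ} (hw : Integrable w μ) {t : ℝ}
    (ht : t ∈ D) : Integrable (fun x => w x * Q t x) μ := by
  obtain ⟨C, hC, h⟩ := hQ.exists_bound hD
  exact hw.mul_bdd (c := C) (hQ.continuous ht).measurable.aestronglyMeasurable
    (Eventually.of_forall fun x => by rw [Real.norm_eq_abs]; exact h t ht x)

/-- Integrals of smooth families against a fixed integrable weight are smooth in time. -/
theorem SmoothFamily.contDiffOn_integral {D : Set ℝ} (hD : IsCompact D) (hconv : Convex ℝ D)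
    (hU : UniqueDiffOn ℝ D) {μ : Measure M} {w : M → ℝ} (hw : Integrable w μ)
    {Q : ℝ → M → ℝ} (hQ : SmoothFamily (m := m) D Q) :
    ContDiffOn ℝ ∞ (fun t => ∫ x, w x * Q t x ∂μ) D := by
  have hder : ∀ Q : ℝ → M → ℝ, SmoothFamily (m := m) D Q → ∀ t ∈ D,
      HasDerivWithinAt (fun t => ∫ x, w x * Q t x ∂μ) (∫ x, w x * timeD D Q t x ∂μ) D t := by
    intro Q hQ t ht
    obtain ⟨C, hC, h⟩ := (hQ.time_deriv hU).exists_bound hD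
    refine (hasDerivWithinAt_integral_of_dominated hconv hU (F' := fun t x => w x * timeD D Q t x)
      (bound := fun x => |w x| * C) (hw.abs.mul_const C)
      (fun t ht => hQ.integrable_mul hD hw ht) (Eventually.of_forall fun x s hs => ⟨?_, ?_⟩) ht).2
    · exact (hQ.hasDerivWithinAt hs x).const_mul _
    · rw [abs_mul]
      exact mul_le_mul_of_nonneg_left (h s hs x) (abs_nonneg _)
  have hk : ∀ (k : ℕ) (Q : ℝ → M → ℝ), SmoothFamily (m := m) D Q →
      ContDiffOn ℝ k (fun t => ∫ x, w x * Q t x ∂μ) D := by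
    intro k
    induction k with
    | zero =>
      intro Q hQ
      exact contDiffOn_zero.2 fun t ht => (hder Q hQ t ht).continuousWithinAt
    | succ k ih =>
      intro Q hQ
      have hs := contDiffOn_succ_iff_derivWithin (n := k) hU
        (f := fun t => ∫ x, w x * Q t x ∂μ)
      refine (hs.2 ⟨fun t ht => (hder Q hQ t ht).differentiableWithinAt, by simp, ?_⟩)
      exact (ih _ (hQ.time_deriv hU)).congr fun t ht => (hder Q hQ t ht).derivWithin (hU t ht)
  exact contDiffOn_infty.2 fun k => hk k Q hQ

end

/-! ### Derivatives of determinants and of dual norms -/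

section MatrixCalculus

variable {m : ℕ} {J : Set ℝ} {G : ℝ → Matrix (Fin m) (Fin m) ℝ} {G' : Matrix (Fin m) (Fin m) ℝ}
  {t : ℝ}

/-- Jacobi's formula. -/
theorem hasDerivWithinAt_det (hG : ∀ i j, HasDerivWithinAt (fun s => G s i j) (G' i j) J t)
    (h0 : (G t).det ≠ 0) :
    HasDerivWithinAt (fun s => (G s).det) ((G t).det * ∑ i, ∑ j, (G t)⁻¹ i j * G' j i) J t := by
  let δ : (Fin m → Fin m → ℝ) → ℝ := fun A => (Matrix.of A).det
  have hδ : Differentiable ℝ δ := by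
    have : δ = fun A => ∑ σ : Equiv.Perm (Fin m), ((Equiv.Perm.sign σ : ℤ) : ℝ) *
        ∏ i, A (σ i) i := by
      funext A
      exact Matrix.det_apply' _
    rw [this]
    fun_prop
  have h1 : HasDerivWithinAt (fun s => (fun i j => G s i j : Fin m → Fin m → ℝ))
      (fun i j => G' i j) J t :=
    hasDerivWithinAt_pi.2 fun i => hasDerivWithinAt_pi.2 fun j => hG i j
  have h2 := (hδ (fun i j => G t i j)).hasFDerivAt.comp_hasDerivWithinAt t h1
  -- the derivative of the determinant in the direction `G'`, along a line
  have h3 : HasDerivAt (fun r : ℝ => δ ((fun i j => G t i j) + r • fun i j => G' i j))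
      (fderiv ℝ δ (fun i j => G t i j) fun i j => G' i j) 0 := by
    have h4 : HasDerivAt (fun r : ℝ => (fun i j => G t i j : Fin m → Fin m → ℝ)
        + r • (fun i j => G' i j)) (fun i j => G' i j) 0 := by
      have := ((hasDerivAt_id (0 : ℝ)).smul_const (fun i j => G' i j : Fin m → Fin m → ℝ)).const_add
        (fun i j => G t i j : Fin m → Fin m → ℝ)
      simpa using this
    have h5 : HasFDerivAt δ (fderiv ℝ δ (fun i j => G t i j))
        ((fun i j => G t i j : Fin m → Fin m → ℝ) + (0 : ℝ) • fun i j => G' i j) := by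
      rw [zero_smul, add_zero]
      exact (hδ _).hasFDerivAt
    exact h5.comp_hasDerivAt 0 h4
  have h6 : HasDerivAt (fun r : ℝ => δ ((fun i j => G t i j) + r • fun i j => G' i j))
      ((G t).det * ((G t)⁻¹ * G').trace) 0 := by
    obtain ⟨P, hP⟩ : ∃ P : Polynomial ℝ, ∀ r : ℝ, det (1 + r • ((G t)⁻¹ * G'))
        = 1 + ((G t)⁻¹ * G').trace * r + P.eval r * r ^ 2 :=
      ⟨_, fun r => Matrix.det_one_add_smul r _⟩
    have h7 : (fun r : ℝ => δ ((fun i j => G t i j) + r • fun i j => G' i j))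
        = fun r => (G t).det * (1 + ((G t)⁻¹ * G').trace * r + P.eval r * r ^ 2) := by
      funext r
      rw [← hP, ← det_mul, mul_add, mul_one, mul_smul_comm, ← mul_assoc,
        Matrix.mul_nonsing_inv _ h0.isUnit, one_mul]
      rfl
    rw [h7]
    have h9 := (((hasDerivAt_id (0 : ℝ)).const_mul ((G t)⁻¹ * G').trace).const_add 1).add
      ((P.hasDerivAt 0).mul ((hasDerivAt_id (0 : ℝ)).pow 2))
    have h10 := h9.const_mul (G t).det
    refine h10.congr_deriv ?_
    simp
  have h8 := h3.unique h6
  rw [h8] at h2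
  exact h2

theorem hasDerivWithinAt_matrix_inv (hG : ∀ i j, HasDerivWithinAt (fun s => G s i j) (G' i j) J t)
    (h0 : ∀ s ∈ J, (G s).det ≠ 0) (ht : t ∈ J) (i j : Fin m) :
    HasDerivWithinAt (fun s => (G s)⁻¹ i j) (-((G t)⁻¹ * G' * (G t)⁻¹) i j) J t := by
  have hinv : ContinuousAt Inv.inv (G t) := continuousAt_matrix_inv _ (by
    rw [show (Ring.inverse : ℝ → ℝ) = Inv.inv from funext fun a => Ring.inverse_eq_inv a]
    exact continuousAt_inv₀ (h0 t ht))
  have hGc : ContinuousWithinAt G J t :=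
    tendsto_pi_nhds.2 fun k => tendsto_pi_nhds.2 fun l => (hG k l).continuousWithinAt
  have h1 : Tendsto (fun s => (G s)⁻¹) (𝓝[J \ {t}] t) (𝓝 (G t)⁻¹) :=
    (hinv.tendsto.comp hGc).mono_left (nhdsWithin_mono _ sdiff_subset)
  have h2 : Tendsto (fun s => (s - t)⁻¹ • (G s - G t)) (𝓝[J \ {t}] t) (𝓝 G') := by
    refine tendsto_pi_nhds.2 fun k => tendsto_pi_nhds.2 fun l => ?_
    refine ((hasDerivWithinAt_iff_tendsto_slope.1 (hG k l))).congr fun s => ?_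
    rw [slope_def_field, div_eq_inv_mul]
    rfl
  have h3 : Tendsto (fun s => -((G s)⁻¹ * ((s - t)⁻¹ • (G s - G t)) * (G t)⁻¹))
      (𝓝[J \ {t}] t) (𝓝 (-((G t)⁻¹ * G' * (G t)⁻¹))) :=
    ((h1.mul h2).mul tendsto_const_nhds).neg
  have h4 := (tendsto_pi_nhds.1 ((tendsto_pi_nhds.1 h3) i)) j
  rw [hasDerivWithinAt_iff_tendsto_slope]
  refine h4.congr' ?_
  filter_upwards [self_mem_nhdsWithin] with s hs
  -- the resolvent identity
  have h5 : -((G s)⁻¹ * ((s - t)⁻¹ • (G s - G t)) * (G t)⁻¹)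
      = (s - t)⁻¹ • ((G s)⁻¹ - (G t)⁻¹) := by
    rw [mul_smul_comm, smul_mul_assoc, mul_sub, sub_mul, ← smul_neg,
      Matrix.nonsing_inv_mul _ (h0 s hs.1).isUnit, one_mul, mul_assoc,
      Matrix.mul_nonsing_inv _ (h0 t ht).isUnit, mul_one, neg_sub]
  rw [h5, slope_def_field, div_eq_inv_mul]
  rfl

/-- The derivative of `s ↦ w(s)ᵀ G(s)⁻¹ w(s)`, where `V = G(t)⁻¹ w(t)`. -/
theorem hasDerivWithinAt_inv_quadratic
    (hG : ∀ i j, HasDerivWithinAt (fun s => G s i j) (G' i j) J t)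
    (hsymm : ∀ s ∈ J, ∀ i j, G s i j = G s j i) (h0 : ∀ s ∈ J, (G s).det ≠ 0) (ht : t ∈ J)
    {w : ℝ → Fin m → ℝ} {w' : Fin m → ℝ} (hw : ∀ i, HasDerivWithinAt (fun s => w s i) (w' i) J t)
    {V : Fin m → ℝ} (hV : ∀ i, V i = ∑ j, (G t)⁻¹ i j * w t j) :
    HasDerivWithinAt (fun s => ∑ i, ∑ j, (G s)⁻¹ i j * w s j * w s i)
      (-(∑ i, ∑ j, G' i j * V i * V j) + 2 * ∑ i, w' i * V i) J t := by
  have hH : ∀ i j, (G t)⁻¹ i j = (G t)⁻¹ j i := fun i j => by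
    have h1 : (G t)ᵀ = G t := by ext k l; exact hsymm t ht l k
    have h2 : ((G t)⁻¹)ᵀ = (G t)⁻¹ := by rw [transpose_nonsing_inv, h1]
    exact congrFun (congrFun h2.symm i) j
  have h1 := HasDerivWithinAt.fun_sum (u := Finset.univ) fun i _ =>
    HasDerivWithinAt.fun_sum (u := Finset.univ) fun j _ =>
      ((hasDerivWithinAt_matrix_inv hG h0 ht i j).mul (hw j)).mul (hw i)
  refine h1.congr_deriv ?_
  have e1 : ∑ i, ∑ j, ((G t)⁻¹ * G' * (G t)⁻¹) i j * w t j * w t i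
      = ∑ k, ∑ l, G' k l * V k * V l := by
    have hVk : V = (G t)⁻¹ *ᵥ w t := funext fun i => hV i
    have hVv : V = w t ᵥ* (G t)⁻¹ := by
      rw [hVk]
      funext i
      simp only [mulVec, vecMul, dotProduct]
      exact Finset.sum_congr rfl fun j _ => by rw [hH i j, mul_comm]
    have e2 : w t ⬝ᵥ ((G t)⁻¹ * G' * (G t)⁻¹) *ᵥ w t = V ⬝ᵥ G' *ᵥ V := by
      rw [← mulVec_mulVec, ← mulVec_mulVec, ← hVk, dotProduct_mulVec, ← hVv]
    simp only [dotProduct, mulVec, Finset.mul_sum] at e2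
    calc _ = ∑ i, ∑ j, w t i * (((G t)⁻¹ * G' * (G t)⁻¹) i j * w t j) :=
          Finset.sum_congr rfl fun i _ => Finset.sum_congr rfl fun j _ => by ring
      _ = _ := e2
      _ = _ := Finset.sum_congr rfl fun i _ => Finset.sum_congr rfl fun j _ => by ring
  have e3 : ∑ i, ∑ j, (G t)⁻¹ i j * w' j * w t i = ∑ i, w' i * V i := by
    rw [Finset.sum_comm]
    refine Finset.sum_congr rfl fun j _ => ?_
    rw [hV, Finset.mul_sum]
    exact Finset.sum_congr rfl fun i _ => by rw [hH]; ring
  have e4 : ∑ i, ∑ j, (G t)⁻¹ i j * w t j * w' i = ∑ i, w' i * V i := by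
    refine Finset.sum_congr rfl fun i _ => ?_
    rw [hV, Finset.mul_sum]
    exact Finset.sum_congr rfl fun j _ => by ring
  rw [two_mul, ← e1]
  nth_rewrite 1 [← e3]
  rw [← e4, ← Finset.sum_neg_distrib, ← Finset.sum_add_distrib, ← Finset.sum_add_distrib]
  refine Finset.sum_congr rfl fun i _ => ?_
  rw [← Finset.sum_neg_distrib, ← Finset.sum_add_distrib, ← Finset.sum_add_distrib]
  refine Finset.sum_congr rfl fun j _ => ?_
  simp only [Pi.mul_apply]
  ring

end MatrixCalculus

/-! ### Evolution of densities, dual norms and Dirichlet energies -/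

section Evolution

variable {m : ℕ} {M : Type*} [TopologicalSpace M] [ChartedSpace (Euc m) M]
  [IsManifold (𝓡 m) ∞ M] {D : Set ℝ} {g : ℝ → Metric m M}

/-- `∂ₜ g = -2 S` on the time set `D`. -/
def EvolvesBy (D : Set ℝ) (g : ℝ → Metric m M)
    (S : ℝ → ∀ x : M, TangentSpace (𝓡 m) x → TangentSpace (𝓡 m) x → ℝ) : Prop :=
  ∀ t ∈ D, ∀ (x : M) (v w : TangentSpace (𝓡 m) x),
    HasDerivWithinAt (fun s => (g s).inner x v w) (-2 * S t x v w) D t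

variable {S : ℝ → ∀ x : M, TangentSpace (𝓡 m) x → TangentSpace (𝓡 m) x → ℝ}

/-- The volume density evolves by `-tr S`. -/
theorem EvolvesBy.hasDerivWithinAt_density (hS : EvolvesBy D g S) (s₀ : ℝ) {t : ℝ} (ht : t ∈ D)
    (x : M) : HasDerivWithinAt (fun s => density g s₀ s x)
      (-(metricTrace (g t) x (S t x)) * density g s₀ t x) D t := by
  have hsymm : ∀ i j, (gram (g t) x)⁻¹ i j = (gram (g t) x)⁻¹ j i := fun i j => by
    have := (gram_posDef (g t) x).isHermitian.inv.apply i j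
    simpa using this.symm
  have hd := (gram_posDef (g t) x).det_pos
  have hd₀ := (gram_posDef (g s₀) x).det_pos
  have h1 := hasDerivWithinAt_det (G := fun s => gram (g s) x)
    (G' := Matrix.of fun i j => -2 * S t x (tangentVec x i) (tangentVec x j))
    (fun i j => hS t ht x (tangentVec x i) (tangentVec x j)) hd.ne'
  have htr : ∑ i, ∑ j, (gram (g t) x)⁻¹ i j
      * (Matrix.of fun i j => -2 * S t x (tangentVec x i) (tangentVec x j)) j i
      = -2 * metricTrace (g t) x (S t x) := by
    rw [metricTrace, Finset.sum_comm, Finset.mul_sum]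
    refine Finset.sum_congr rfl fun i _ => ?_
    rw [Finset.mul_sum]
    refine Finset.sum_congr rfl fun j _ => ?_
    rw [hsymm i j, Matrix.of_apply]
    ring
  rw [htr] at h1
  have h2 := (h1.div_const (gram (g s₀) x).det).sqrt (div_pos hd hd₀).ne'
  refine h2.congr_deriv ?_
  have h3 : density g s₀ t x ^ 2 = (gram (g t) x).det / (gram (g s₀) x).det :=
    Real.sq_sqrt (detRatio_pos g t s₀ x).le
  have h4 := density_pos g s₀ t x
  change _ / (2 * density g s₀ t x) = _
  rw [div_eq_iff (by positivity)]
  have h5 : (gram (g t) x).det = density g s₀ t x ^ 2 * (gram (g s₀) x).det := by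
    rw [h3, div_mul_cancel₀ _ hd₀.ne']
  rw [h5]
  field_simp

/-- The evolution of the squared norm of a moving covector. -/
theorem EvolvesBy.hasDerivWithinAt_conorm_sq (hS : EvolvesBy D g S) (hU : UniqueDiffOn ℝ D)
    {t : ℝ} (ht : t ∈ D) (x : M) {θ : ℝ → TangentSpace (𝓡 m) x →L[ℝ] ℝ}
    {θ' : TangentSpace (𝓡 m) x →L[ℝ] ℝ}
    (hθ : ∀ v, HasDerivWithinAt (fun s => θ s v) (θ' v) D t) :
    HasDerivWithinAt (fun s => conorm (g s) x (θ s) ^ 2)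
      (2 * (S t x (sharp (g t) x (θ t)) (sharp (g t) x (θ t))
        + (g t).inner x (sharp (g t) x θ') (sharp (g t) x (θ t)))) D t := by
  set V : Fin m → ℝ := fun i => ∑ j, (gram (g t) x)⁻¹ i j * θ t (tangentVec x j) with hV
  have hsharp : sharp (g t) x (θ t) = ∑ i, V i • tangentVec x i := rfl
  have h1 := hasDerivWithinAt_inv_quadratic (G := fun s => gram (g s) x)
    (G' := Matrix.of fun i j => -2 * S t x (tangentVec x i) (tangentVec x j))
    (w := fun s i => θ s (tangentVec x i)) (w' := fun i => θ' (tangentVec x i)) (V := V)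
    (fun i j => hS t ht x (tangentVec x i) (tangentVec x j))
    (fun s _ i j => (g s).symm x _ _) (fun s _ => (gram_posDef (g s) x).det_pos.ne') ht
    (fun i => hθ _) (fun i => rfl)
  have h2 : (fun s => conorm (g s) x (θ s) ^ 2) = fun s => ∑ i, ∑ j, (gram (g s) x)⁻¹ i j
      * θ s (tangentVec x j) * θ s (tangentVec x i) := by
    funext s
    have := conorm_sq_eq_sum (g s) x (tangentBasis x) (θ s)
    simpa only [gramOf_tangentBasis, tangentBasis_apply] using this
  rw [h2]
  refine h1.congr_deriv ?_
  have h3 : ∑ i, θ' (tangentVec x i) * V i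
      = (g t).inner x (sharp (g t) x θ') (sharp (g t) x (θ t)) := by
    rw [inner_sharp, hsharp, map_sum]
    exact Finset.sum_congr rfl fun i _ => by rw [map_smul, smul_eq_mul, mul_comm]
  -- the value of `S` on `(θ t)♯`, from the evolution of the metric on this fixed vector
  have h4 : ∑ i, ∑ j, V i * V j * (-2 * S t x (tangentVec x i) (tangentVec x j))
      = -2 * S t x (sharp (g t) x (θ t)) (sharp (g t) x (θ t)) := by
    have h5 := hS t ht x (sharp (g t) x (θ t)) (sharp (g t) x (θ t))
    have h6 : HasDerivWithinAt
        (fun s => (g s).inner x (sharp (g t) x (θ t)) (sharp (g t) x (θ t)))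
        (∑ i, ∑ j, V i * V j * (-2 * S t x (tangentVec x i) (tangentVec x j))) D t := by
      simp only [hsharp, inner_sum_sum]
      exact HasDerivWithinAt.fun_sum fun i _ => HasDerivWithinAt.fun_sum fun j _ =>
        (hS t ht x _ _).const_mul _
    exact (hU t ht).eq_deriv _ h6 h5
  have h7 : ∑ i, ∑ j, (Matrix.of fun i j => -2 * S t x (tangentVec x i) (tangentVec x j)) i j
      * V i * V j = ∑ i, ∑ j, V i * V j * (-2 * S t x (tangentVec x i) (tangentVec x j)) :=
    Finset.sum_congr rfl fun i _ => Finset.sum_congr rfl fun j _ => by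
      rw [Matrix.of_apply]; ring
  rw [h3, h7, h4]
  ring

theorem eq_zero_of_conorm_eq_zero {g : Metric m M} {x : M} {ξ : TangentSpace (𝓡 m) x →L[ℝ] ℝ}
    (h : conorm g x ξ = 0) : ξ = 0 ∧ sharp g x ξ = 0 := by
  have h1 : sharp g x ξ = 0 := by
    by_contra hne
    have := g.pos x _ hne
    rw [← conorm_sq, h] at this
    simp at this
  refine ⟨?_, h1⟩
  ext v
  rw [← inner_sharp g x ξ v, h1]
  simp

/-- At a zero of a moving covector, its norm to the power `p > 1` has derivative zero. -/
theorem hasDerivWithinAt_conorm_rpow_of_eq_zero {C : ℝ} {t : ℝ} (x : M)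
    (hC : ∀ s ∈ D, ∀ ξ : TangentSpace (𝓡 m) x →L[ℝ] ℝ,
      conorm (g s) x ξ ≤ C * conorm (g t) x ξ)
    {θ : ℝ → TangentSpace (𝓡 m) x →L[ℝ] ℝ}
    {θ' : TangentSpace (𝓡 m) x →L[ℝ] ℝ}
    (hθ : ∀ v, HasDerivWithinAt (fun s => θ s v) (θ' v) D t) {p : ℝ} (hp : 1 < p)
    (h0 : conorm (g t) x (θ t) = 0) :
    HasDerivWithinAt (fun s => conorm (g s) x (θ s) ^ p) 0 D t := by
  obtain ⟨hθ0, -⟩ := eq_zero_of_conorm_eq_zero h0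
  have hO : ∀ i, (fun s => θ s (tangentVec x i)) =O[𝓝[D] t] fun s => s - t := by
    intro i
    have := (hθ (tangentVec x i)).isBigO_sub
    simpa [hθ0, Function.comp_def] using this
  have h1 : (fun s => conorm (g t) x (θ s) ^ 2) =O[𝓝[D] t] fun s => (s - t) ^ 2 := by
    have h2 : (fun s => conorm (g t) x (θ s) ^ 2) = fun s => ∑ i, ∑ j, (gram (g t) x)⁻¹ i j
        * θ s (tangentVec x j) * θ s (tangentVec x i) := by
      funext s
      have := conorm_sq_eq_sum (g t) x (tangentBasis x) (θ s)
      simpa only [gramOf_tangentBasis, tangentBasis_apply] using this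
    rw [h2]
    refine IsBigO.fun_sum fun i _ => IsBigO.fun_sum fun j _ => ?_
    simp only [sq]
    exact ((hO j).const_mul_left _).mul (hO i)
  have h3 : (fun s => conorm (g s) x (θ s) ^ 2) =O[𝓝[D] t] fun s => (s - t) ^ 2 := by
    refine IsBigO.trans (IsBigO.of_bound (C ^ 2) ?_) h1
    filter_upwards [self_mem_nhdsWithin] with s hs
    rw [Real.norm_of_nonneg (sq_nonneg _), Real.norm_of_nonneg (sq_nonneg _), ← mul_pow]
    exact pow_le_pow_left₀ (conorm_nonneg ..) (hC s hs _) 2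
  have h4 := h3.rpow (r := p / 2) (by linarith) (Eventually.of_forall fun s => sq_nonneg _)
  have hpow : ∀ c : ℝ, (c ^ 2) ^ (p / 2) = |c| ^ p := fun c => by
    rw [← sq_abs, ← Real.rpow_natCast, ← Real.rpow_mul (abs_nonneg c)]
    congr 1
    push_cast
    ring
  simp only [hpow] at h4
  have h5 : (fun s => |s - t| ^ p) =o[𝓝[D] t] fun s => s - t := by
    have h6 : HasDerivAt (fun y : ℝ => |y| ^ p) 0 (t - t) := by
      rw [sub_self]
      simpa using hasDerivAt_abs_rpow 0 hp
    have h7 := HasDerivAt.comp t (h₂ := fun y : ℝ => |y| ^ p) (h := fun s => s - t) h6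
      ((hasDerivAt_id t).sub_const t)
    have h8 := hasDerivAt_iff_isLittleO.1 h7
    simp only [Function.comp_def, sub_self, abs_zero, Real.zero_rpow (by linarith : p ≠ 0),
      sub_zero, mul_one, smul_zero] at h8
    exact h8.mono nhdsWithin_le_nhds
  rw [hasDerivWithinAt_iff_isLittleO]
  have h9 := h4.trans_isLittleO h5
  simpa only [abs_of_nonneg (conorm_nonneg _ _ _), h0, Real.zero_rpow (by linarith : p ≠ 0),
    sub_zero, smul_zero] using h9

/-- The evolution of a power of the norm of a moving covector. -/
theorem EvolvesBy.hasDerivWithinAt_conorm_rpow [CompactSpace M] (hS : EvolvesBy D g S)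
    (hg : SmoothMetric D g) (hD : IsCompact D) (hU : UniqueDiffOn ℝ D)
    {t : ℝ} (ht : t ∈ D) (x : M) {θ : ℝ → TangentSpace (𝓡 m) x →L[ℝ] ℝ}
    {θ' : TangentSpace (𝓡 m) x →L[ℝ] ℝ}
    (hθ : ∀ v, HasDerivWithinAt (fun s => θ s v) (θ' v) D t) {p : ℝ} (hp : 1 < p) :
    HasDerivWithinAt (fun s => conorm (g s) x (θ s) ^ p)
      (p * ((S t x (sharp (g t) x (θ t)) (sharp (g t) x (θ t))
        + (g t).inner x (sharp (g t) x θ') (sharp (g t) x (θ t)))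
          * conorm (g t) x (θ t) ^ (p - 2))) D t := by
  have h1 := hS.hasDerivWithinAt_conorm_sq hU ht x hθ
  rcases (conorm_nonneg (g t) x (θ t)).eq_or_lt with h0 | h0
  · obtain ⟨C, hC, h⟩ := hg.exists_equiv hD
    refine (hasDerivWithinAt_conorm_rpow_of_eq_zero x (fun s hs ξ => h t ht s hs x ξ) hθ hp
      h0.symm).congr_deriv ?_
    obtain ⟨-, hs0⟩ := eq_zero_of_conorm_eq_zero h0.symm
    have h2 := hS t ht x 0 0
    have h3 : HasDerivWithinAt (fun s => (g s).inner x 0 0) 0 D t := by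
      simpa using hasDerivWithinAt_const (c := (0 : ℝ)) t D
    have h4 := (hU t ht).eq_deriv _ h2 h3
    have h5 : S t x 0 0 = 0 := by linarith
    rw [hs0, h5]
    simp
  · have hpow : ∀ (c e : ℝ), 0 ≤ c → (c ^ 2) ^ (e / 2) = c ^ e := fun c e hc => by
      rw [← Real.rpow_natCast, ← Real.rpow_mul hc]
      congr 1
      push_cast
      ring
    have h2 := h1.rpow_const (p := p / 2) (Or.inl (pow_pos h0 2).ne')
    rw [show p / 2 - 1 = (p - 2) / 2 by ring, hpow _ _ h0.le] at h2
    simp only [hpow _ _ (conorm_nonneg _ _ _)] at h2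
    refine h2.congr_deriv ?_
    ring

end Evolution

section EnergyEvolution

variable {m : ℕ} {M : Type*} [TopologicalSpace M] [ChartedSpace (Euc m) M]
  [IsManifold (𝓡 m) ∞ M] [CompactSpace M] {D : Set ℝ} {g : ℝ → Metric m M}

/-- The differential of `a t * u`, measured at time `s`, in terms of the differential of `u`. -/
theorem SmoothMetric.exists_conorm_mul_bound (hg : SmoothMetric D g) (hD : IsCompact D)
    (hU : UniqueDiffOn ℝ D) {a : ℝ → M → ℝ} (ha : SmoothFamily (m := m) D a) {s₀ : ℝ}
    (hs₀ : s₀ ∈ D) : ∃ K, 0 ≤ K ∧ ∀ t ∈ D, ∀ (x : M) (ξ : TangentSpace (𝓡 m) x →L[ℝ] ℝ) (r : ℝ),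
      conorm (g t) x (a t x • ξ + r • dcov (a t) x) ≤ K * (conorm (g s₀) x ξ + |r|) := by
  obtain ⟨C₁, hC₁, h1⟩ := ha.exists_bound hD
  obtain ⟨C₂, hC₂, h2⟩ := hg.exists_dcov_bound hD ha hU
  obtain ⟨C₃, hC₃, h3⟩ := hg.exists_equiv hD
  refine ⟨C₁ * C₃ + C₂, by positivity, fun t ht x ξ r => ?_⟩
  refine (conorm_add_le ..).trans ?_
  rw [conorm_smul, conorm_smul]
  have e1 := mul_le_mul (h1 t ht x) (h3 s₀ hs₀ t ht x ξ) (conorm_nonneg ..) hC₁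
  have e2 := mul_le_mul_of_nonneg_left (h2 t ht t ht x) (abs_nonneg r)
  have e3 : 0 ≤ C₁ * C₃ * |r| := by positivity
  have e4 : 0 ≤ C₂ * conorm (g s₀) x ξ := mul_nonneg hC₂ (conorm_nonneg ..)
  linarith

variable [MeasurableSpace M] [BorelSpace M]

theorem weakDifferential_mul_ae (h : Metric m M) {a : ℝ → M → ℝ} (ha : SmoothFamily (m := m) D a)
    {t : ℝ} (ht : t ∈ D) {u : M → ℝ}
    (hu : ∃ ξ : ∀ x : M, TangentSpace (𝓡 m) x →L[ℝ] ℝ, IsWeakDifferential u ξ) :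
    ∀ᵐ x ∂(riemannianVolume h),
      (weakDifferential (fun x => a t x * u x) : ∀ x : M, TangentSpace (𝓡 m) x →L[ℝ] ℝ) x
        = a t x • weakDifferential u x + u x • dcov (a t) x := by
  obtain ⟨ξ, hξ⟩ := hu
  have h1 := (isWeakDifferential_weakDifferential hξ).smooth_mul ha ht
  exact (isWeakDifferential_weakDifferential h1).ae_eq h1 h

/-- `W^{1,p}` is stable under multiplication by smooth functions, and does not depend on the
metric. -/
theorem SmoothMetric.memW_mul (hg : SmoothMetric D g) (hD : IsCompact D)
    (hU : UniqueDiffOn ℝ D) {a : ℝ → M → ℝ} (ha : SmoothFamily (m := m) D a) {s₀ t : ℝ}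
    (hs₀ : s₀ ∈ D) (ht : t ∈ D) {p : ℝ} {u : M → ℝ} (hu : MemW (g s₀) p u) :
    MemW (g t) p (fun x => a t x * u x) := by
  obtain ⟨hup, hex, hgr⟩ := hu
  obtain ⟨ξ, hξ⟩ := id hex
  have h1 := (isWeakDifferential_weakDifferential hξ).smooth_mul ha ht
  obtain ⟨C, hC, hbd⟩ := ha.exists_bound hD
  obtain ⟨K, hK, hKb⟩ := hg.exists_conorm_mul_bound hD hU ha hs₀
  refine ⟨hg.memLp hs₀ ht ?_, ⟨_, h1⟩, hg.memLp hs₀ ht ?_⟩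
  · exact MemLp.of_le_mul (c := C) hup
      ((ha.continuous ht).measurable.aestronglyMeasurable.mul hup.aestronglyMeasurable)
      (Eventually.of_forall fun x => by
        rw [norm_mul]
        exact mul_le_mul_of_nonneg_right (hbd t ht x) (norm_nonneg _))
  · refine MemLp.of_le_mul (c := K) (hgr.add hup.abs)
      (hg.aestronglyMeasurable_conorm ht (isWeakDifferential_weakDifferential h1) s₀) ?_
    filter_upwards [weakDifferential_mul_ae (g s₀) ha ht hex] with x hx
    change ‖conorm (g t) x _‖ ≤ _
    rw [hx, Real.norm_of_nonneg (conorm_nonneg ..)]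
    refine (hKb t ht x _ _).trans (mul_le_mul_of_nonneg_left ?_ hK)
    exact le_abs_self (gradNorm (g s₀) u x + |u x|)

variable {S : ℝ → ∀ x : M, TangentSpace (𝓡 m) x → TangentSpace (𝓡 m) x → ℝ}

/-- The evolution of the Dirichlet energy of `a t * u` under `∂ₜ g = -2 S`. -/
theorem EvolvesBy.hasDerivWithinAt_dirichlet (hS : EvolvesBy D g S)
    (hg : SmoothMetric D g) (hD : IsCompact D) (hconv : Convex ℝ D) (hU : UniqueDiffOn ℝ D)
    (hD' : D ⊆ closure (interior D)) {a : ℝ → M → ℝ} (ha : SmoothFamily (m := m) D a) {s₀ : ℝ}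
    (hs₀ : s₀ ∈ D) {p : ℝ} (hp : 1 < p) {u : M → ℝ} (hu : MemW (g s₀) p u)
    {w w' : ℝ → M → ℝ} (hw : ∀ t ∈ D, w t = fun x => a t x * u x)
    (hw' : ∀ t ∈ D, w' t = fun x => timeD D a t x * u x) :
    ∃ C : ℝ, ∀ t ∈ D, HasDerivWithinAt
        (fun s => ∫ x, gradNorm (g s) (w s) x ^ p ∂(riemannianVolume (g s)))
        (p * (∫ x, (S t x (gradient (g t) (w t) x) (gradient (g t) (w t) x)
            + (g t).inner x (gradient (g t) (w' t) x) (gradient (g t) (w t) x))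
            * gradNorm (g t) (w t) x ^ (p - 2) ∂(riemannianVolume (g t)))
          - ∫ x, gradNorm (g t) (w t) x ^ p * metricTrace (g t) x (S t x)
            ∂(riemannianVolume (g t))) D t ∧
      |p * (∫ x, (S t x (gradient (g t) (w t) x) (gradient (g t) (w t) x)
            + (g t).inner x (gradient (g t) (w' t) x) (gradient (g t) (w t) x))
            * gradNorm (g t) (w t) x ^ (p - 2) ∂(riemannianVolume (g t)))
          - ∫ x, gradNorm (g t) (w t) x ^ p * metricTrace (g t) x (S t x)
            ∂(riemannianVolume (g t))| ≤ C := by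
  obtain ⟨hup, hex, hgr⟩ := id hu
  obtain ⟨ξ₀, hξ₀⟩ := id hex
  have ha' := ha.time_deriv hU
  set ξ : ∀ x : M, TangentSpace (𝓡 m) x →L[ℝ] ℝ := weakDifferential u with hξ
  -- the differentials of `a t * u` and of its time derivative
  let θ : ℝ → ∀ x : M, TangentSpace (𝓡 m) x →L[ℝ] ℝ :=
    fun t x => a t x • ξ x + u x • dcov (a t) x
  let θ' : ℝ → ∀ x : M, TangentSpace (𝓡 m) x →L[ℝ] ℝ :=
    fun t x => timeD D a t x • ξ x + u x • dcov (timeD D a t) x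
  have hwθ : ∀ t ∈ D, ∀ s, ∀ᵐ x ∂(riemannianVolume (g s)),
      (weakDifferential (w t) : ∀ x : M, TangentSpace (𝓡 m) x →L[ℝ] ℝ) x = θ t x := fun t ht s => by
    rw [hw t ht]
    exact weakDifferential_mul_ae (g s) ha ht hex
  have hwθ' : ∀ t ∈ D, ∀ s, ∀ᵐ x ∂(riemannianVolume (g s)),
      (weakDifferential (w' t) : ∀ x : M, TangentSpace (𝓡 m) x →L[ℝ] ℝ) x = θ' t x :=
    fun t ht s => by
      rw [hw' t ht]
      exact weakDifferential_mul_ae (g s) ha' ht hex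
  have hθ : ∀ t ∈ D, ∀ x v, HasDerivWithinAt (fun s => θ s x v) (θ' t x v) D t :=
    fun t ht x v => ((ha.hasDerivWithinAt ht x).mul_const (ξ x v)).add
      ((ha.hasDerivWithinAt_dcov hU hD' ht x v).const_mul (u x))
  let A : ℝ → M → ℝ := fun t x => (S t x (sharp (g t) x (θ t x)) (sharp (g t) x (θ t x))
    + (g t).inner x (sharp (g t) x (θ' t x)) (sharp (g t) x (θ t x)))
      * conorm (g t) x (θ t x) ^ (p - 2)
  let B : ℝ → M → ℝ := fun t x => conorm (g t) x (θ t x) ^ p * metricTrace (g t) x (S t x)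
  let F : ℝ → M → ℝ := fun t x => conorm (g t) x (θ t x) ^ p * density g s₀ t x
  let F' : ℝ → M → ℝ := fun t x => p * (A t x * density g s₀ t x) - B t x * density g s₀ t x
  have hFF' : ∀ t ∈ D, ∀ x, HasDerivWithinAt (fun s => F s x) (F' t x) D t := fun t ht x => by
    refine ((hS.hasDerivWithinAt_conorm_rpow hg hD hU ht x (hθ t ht x) hp).mul
      (hS.hasDerivWithinAt_density s₀ ht x)).congr_deriv ?_
    simp only [F', A, B]
    ring
  -- uniform bounds
  obtain ⟨Cs, hCs, hSb⟩ := hg.exists_deriv_bound hD hU (fun t x v => -2 * S t x v v)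
    fun t ht x v => hS t ht x v v
  obtain ⟨K₁, hK₁, hb1⟩ := hg.exists_conorm_mul_bound hD hU ha hs₀
  obtain ⟨K₂, hK₂, hb2⟩ := hg.exists_conorm_mul_bound hD hU ha' hs₀
  obtain ⟨C₁, hC₁, hd1⟩ := (hg.density hs₀).exists_bound hD
  obtain ⟨C₂, hC₂, hd2⟩ := ((hg.density hs₀).time_deriv hU).exists_bound hD
  let Y : M → ℝ := fun x => (K₁ + K₂) * (conorm (g s₀) x (ξ x) + |u x|)
  have hX : ∀ x, 0 ≤ conorm (g s₀) x (ξ x) + |u x| := fun x =>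
    add_nonneg (conorm_nonneg ..) (abs_nonneg _)
  have hY0 : ∀ x, 0 ≤ Y x := fun x => mul_nonneg (add_nonneg hK₁ hK₂) (hX x)
  have hθY : ∀ t ∈ D, ∀ x, conorm (g t) x (θ t x) ≤ Y x := fun t ht x =>
    (hb1 t ht x _ _).trans (mul_le_mul_of_nonneg_right (by linarith) (hX x))
  have hθY' : ∀ t ∈ D, ∀ x, conorm (g t) x (θ' t x) ≤ Y x := fun t ht x =>
    (hb2 t ht x _ _).trans (mul_le_mul_of_nonneg_right (by linarith) (hX x))
  have hYp : Integrable (fun x => Y x ^ p) (riemannianVolume (g s₀)) := by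
    have h1 : MemLp Y (ENNReal.ofReal p) (riemannianVolume (g s₀)) :=
      (hgr.add hup.abs).const_mul (K₁ + K₂)
    have h2 := h1.integrable_norm_rpow (by simpa using by linarith) ENNReal.ofReal_ne_top
    rw [ENNReal.toReal_ofReal (by linarith)] at h2
    refine h2.congr (Eventually.of_forall fun x => ?_)
    simp only [Real.norm_of_nonneg (hY0 x)]
  have hcp : ∀ t ∈ D, ∀ x, conorm (g t) x (θ t x) ^ p ≤ Y x ^ p := fun t ht x =>
    Real.rpow_le_rpow (conorm_nonneg ..) (hθY t ht x) (by linarith)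
  have hA : ∀ t ∈ D, ∀ x, |A t x| ≤ (Cs + 1) * Y x ^ p := by
    intro t ht x
    have hc := conorm_nonneg (g t) x (θ t x)
    have e1 : |S t x (sharp (g t) x (θ t x)) (sharp (g t) x (θ t x))|
        ≤ Cs * conorm (g t) x (θ t x) ^ 2 := by
      have := hSb t ht x (sharp (g t) x (θ t x))
      rw [← conorm_sq, abs_mul] at this
      norm_num at this
      linarith [abs_nonneg (S t x (sharp (g t) x (θ t x)) (sharp (g t) x (θ t x)))]
    have e2 := abs_inner_sharp_le (g t) x (θ' t x) (θ t x)
    have hcancel : ∀ e : ℝ, 0 < e → conorm (g t) x (θ t x) * conorm (g t) x (θ t x) ^ (e - 1)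
        = conorm (g t) x (θ t x) ^ e := fun e he => by
      rcases hc.eq_or_lt with h0 | h0
      · rw [← h0, zero_mul, Real.zero_rpow he.ne']
      · rw [Real.rpow_sub_one h0.ne', mul_div_cancel₀ _ h0.ne']
    have hcY : conorm (g t) x (θ t x) ^ (p - 1) ≤ Y x ^ (p - 1) :=
      Real.rpow_le_rpow hc (hθY t ht x) (by linarith)
    have hYY : Y x * Y x ^ (p - 1) = Y x ^ p := by
      rcases (hY0 x).eq_or_lt with h0 | h0
      · rw [← h0, zero_mul, Real.zero_rpow (by linarith)]
      · rw [Real.rpow_sub_one h0.ne', mul_div_cancel₀ _ h0.ne']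
    have e3 := hcancel (p - 1) (by linarith)
    rw [show p - 1 - 1 = p - 2 by ring] at e3
    calc |A t x| ≤ (Cs * conorm (g t) x (θ t x) ^ 2
          + conorm (g t) x (θ' t x) * conorm (g t) x (θ t x))
            * conorm (g t) x (θ t x) ^ (p - 2) := by
          rw [abs_mul, abs_of_nonneg (Real.rpow_nonneg hc (p - 2))]
          exact mul_le_mul_of_nonneg_right ((abs_add_le _ _).trans (add_le_add e1 e2))
            (Real.rpow_nonneg hc _)
      _ = Cs * (conorm (g t) x (θ t x)
            * (conorm (g t) x (θ t x) * conorm (g t) x (θ t x) ^ (p - 2)))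
          + conorm (g t) x (θ' t x)
            * (conorm (g t) x (θ t x) * conorm (g t) x (θ t x) ^ (p - 2)) := by ring
      _ = Cs * conorm (g t) x (θ t x) ^ p
          + conorm (g t) x (θ' t x) * conorm (g t) x (θ t x) ^ (p - 1) := by
          rw [e3, hcancel p (by linarith)]
      _ ≤ Cs * Y x ^ p + Y x * Y x ^ (p - 1) :=
          add_le_add (mul_le_mul_of_nonneg_left (hcp t ht x) hCs)
            (mul_le_mul (hθY' t ht x) hcY (Real.rpow_nonneg hc _) (hY0 x))
      _ = (Cs + 1) * Y x ^ p := by rw [hYY]; ring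
  -- the trace of `S` is controlled through the time derivative of the density
  have hB : ∀ t ∈ D, ∀ x, B t x * density g s₀ t x
      = -(conorm (g t) x (θ t x) ^ p * timeD D (density g s₀) t x) := by
    intro t ht x
    have := (hU t ht).eq_deriv _ (hS.hasDerivWithinAt_density s₀ ht x)
      ((hg.density hs₀).hasDerivWithinAt ht x)
    rw [← this]
    simp only [B]
    ring
  have hBb : ∀ t ∈ D, ∀ x, |B t x * density g s₀ t x| ≤ C₂ * Y x ^ p := by
    intro t ht x
    rw [hB t ht x, abs_neg, abs_mul, abs_of_nonneg (Real.rpow_nonneg (conorm_nonneg ..) _),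
      mul_comm]
    exact mul_le_mul (hd2 t ht x) (hcp t ht x) (Real.rpow_nonneg (conorm_nonneg ..) _) hC₂
  have hcm : ∀ t ∈ D, AEStronglyMeasurable (fun x => conorm (g t) x (θ t x) ^ p)
      (riemannianVolume (g s₀)) := fun t ht =>
    ((hg.aestronglyMeasurable_conorm ht ((isWeakDifferential_weakDifferential hξ₀).smooth_mul ha ht)
      s₀).aemeasurable.pow_const p).aestronglyMeasurable
  have hFi : ∀ t ∈ D, Integrable (F t) (riemannianVolume (g s₀)) := fun t ht => by
    refine (hYp.const_mul C₁).mono'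
      ((hcm t ht).mul ((hg.density hs₀).continuous ht).measurable.aestronglyMeasurable)
      (Eventually.of_forall fun x => ?_)
    rw [Real.norm_eq_abs, abs_mul, abs_of_nonneg (Real.rpow_nonneg (conorm_nonneg ..) _), mul_comm]
    exact mul_le_mul (hd1 t ht x) (hcp t ht x) (Real.rpow_nonneg (conorm_nonneg ..) _) hC₁
  have hBi : ∀ t ∈ D, Integrable (fun x => B t x * density g s₀ t x) (riemannianVolume (g s₀)) := by
    intro t ht
    refine (hYp.const_mul C₂).mono' ?_ (Eventually.of_forall fun x => hBb t ht x)
    refine (((hcm t ht).mul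
      (((hg.density hs₀).time_deriv hU).continuous ht).measurable.aestronglyMeasurable).neg).congr
      (Eventually.of_forall fun x => (hB t ht x).symm)
  have hF'b : ∀ t ∈ D, ∀ x, |F' t x| ≤ (p * ((Cs + 1) * C₁) + C₂) * Y x ^ p := by
    intro t ht x
    refine (abs_sub _ _).trans ?_
    rw [add_mul]
    refine add_le_add ?_ (hBb t ht x)
    rw [abs_mul, abs_mul, abs_of_pos (by linarith : 0 < p), mul_assoc]
    refine mul_le_mul_of_nonneg_left ?_ (by linarith)
    rw [mul_right_comm]
    exact mul_le_mul (hA t ht x) (hd1 t ht x) (abs_nonneg _)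
      (mul_nonneg (by linarith) (Real.rpow_nonneg (hY0 x) _))
  have hmain := fun t (ht : t ∈ D) => hasDerivWithinAt_integral_of_dominated
    (μ := riemannianVolume (g s₀)) hconv hU (hYp.const_mul _) hFi
    (Eventually.of_forall fun x s hs => ⟨hFF' s hs x, hF'b s hs x⟩) ht
  have hAi : ∀ t ∈ D, Integrable (fun x => A t x * density g s₀ t x) (riemannianVolume (g s₀)) := by
    intro t ht
    refine (((hmain t ht).1.add (hBi t ht)).const_mul p⁻¹).congr (Eventually.of_forall fun x => ?_)
    have : p ≠ 0 := by linarith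
    simp only [F', Pi.add_apply, sub_add_cancel]
    field_simp
  -- pass to the fixed measure
  have hE : ∀ t ∈ D, ∫ x, gradNorm (g t) (w t) x ^ p ∂(riemannianVolume (g t))
      = ∫ x, F t x ∂(riemannianVolume (g s₀)) := by
    intro t ht
    rw [hg.integral_eq hs₀ ht]
    refine integral_congr_ae ?_
    filter_upwards [hwθ t ht s₀] with x hx
    change conorm (g t) x _ ^ p * _ = _
    rw [hx]
  have hrate : ∀ t ∈ D,
      p * (∫ x, (S t x (gradient (g t) (w t) x) (gradient (g t) (w t) x)
            + (g t).inner x (gradient (g t) (w' t) x) (gradient (g t) (w t) x))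
            * gradNorm (g t) (w t) x ^ (p - 2) ∂(riemannianVolume (g t)))
          - ∫ x, gradNorm (g t) (w t) x ^ p * metricTrace (g t) x (S t x)
            ∂(riemannianVolume (g t)) = ∫ x, F' t x ∂(riemannianVolume (g s₀)) := by
    intro t ht
    simp only [F']
    rw [integral_sub ((hAi t ht).const_mul p) (hBi t ht), integral_const_mul,
      hg.integral_eq hs₀ ht, hg.integral_eq hs₀ ht]
    congr 1
    · congr 1
      refine integral_congr_ae ?_
      filter_upwards [hwθ t ht s₀, hwθ' t ht s₀] with x hx hx'
      simp only [gradNorm, gradient, hx, hx']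
      rfl
    · refine integral_congr_ae ?_
      filter_upwards [hwθ t ht s₀] with x hx
      simp only [gradNorm, gradient, hx]
      rfl
  refine ⟨∫ x, (p * ((Cs + 1) * C₁) + C₂) * Y x ^ p ∂(riemannianVolume (g s₀)), fun t ht => ?_⟩
  rw [hrate t ht]
  refine ⟨(hmain t ht).2.congr (fun s hs => hE s hs) (hE t ht), ?_⟩
  exact (abs_integral_le_integral_abs).trans
    (integral_mono (hmain t ht).1.abs (hYp.const_mul _) (hF'b t ht))

end EnergyEvolution

/-! ### The flow and the first eigenvalue -/

section Flow

variable {m n : ℕ} {M : Type*} [TopologicalSpace M] [ChartedSpace (Euc m) M]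
  [IsManifold (𝓡 m) ∞ M] {N : Type*} [TopologicalSpace N] [ChartedSpace (Euc n) N]
  [IsManifold (𝓡 n) ∞ N] {γ : Metric n N} {κ : ℝ} {T : EReal} {g : ℝ → Metric m M}
  {φ : ℝ → M → N} {D : Set ℝ}

theorem IsRHFlow.smoothMetric (h : IsRHFlow γ κ T g φ) (hD : D ⊆ timeDomain T) :
    SmoothMetric D g :=
  fun c i j => (h.smooth_metric c i j).mono (prod_mono hD Subset.rfl)

theorem IsRHFlow.evolvesBy (h : IsRHFlow γ κ T g φ) (hD : D ⊆ timeDomain T) :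
    EvolvesBy D g fun t => tensorS γ κ (g t) (φ t) := fun t ht x v w =>
  ((h.metric_eq t (hD ht) x v w).mono hD).congr_deriv (by simp only [tensorS]; ring)

theorem metricTrace_tensorS (γ : Metric n N) (κ : ℝ) (g : Metric m M) (φ : M → N) (x : M) :
    metricTrace g x (tensorS γ κ g φ x) = scalarS γ κ g φ x := by
  simp only [metricTrace, tensorS, scalarS, Finset.mul_sum, ← Finset.sum_sub_distrib]
  exact Finset.sum_congr rfl fun i _ => Finset.sum_congr rfl fun j _ => by ring

end Flow

section Eigenvalue

variable {m : ℕ} {M : Type*} [TopologicalSpace M] [ChartedSpace (Euc m) M]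
  [IsManifold (𝓡 m) ∞ M] [CompactSpace M] [MeasurableSpace M] [BorelSpace M]
  {p q α β : ℝ}

omit [CompactSpace M] [MeasurableSpace M] [BorelSpace M] in
theorem gradNorm_rpow_mul_inner (g : Metric m M) (u : M → ℝ) (x : M) (hp : 1 < p) :
    gradNorm g u x ^ (p - 2) * g.inner x (gradient g u x) (gradient g u x)
      = gradNorm g u x ^ p := by
  have h0 : 0 ≤ gradNorm g u x := Real.sqrt_nonneg _
  have h1 : g.inner x (gradient g u x) (gradient g u x) = gradNorm g u x ^ (2 : ℝ) := by
    rw [Real.rpow_two, gradNorm, Real.sq_sqrt (inner_self_nonneg g x _)]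
  rcases h0.eq_or_lt with h | h
  · rw [h1, ← h, Real.zero_rpow (by norm_num : (2 : ℝ) ≠ 0), mul_zero,
      Real.zero_rpow (by linarith)]
  · rw [h1, ← Real.rpow_add h, sub_add_cancel]

omit [BorelSpace M] in
/-- The energy of a normalized weak solution is its eigenvalue: test the system with the solution
itself. -/
theorem IsWeakSolution.energy_eq {g : Metric m M} {Λ : ℝ} {u v : M → ℝ} (hp : 1 < p) (hq : 1 < q)
    (hpq : (α + 1) / p + (β + 1) / q = 1) (h : IsWeakSolution p q α β g Λ u v)
    (hu : MemW g p u) (hv : MemW g q v) (hB : coupling α β g u v = 1) :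
    energy p q α β g u v = Λ := by
  have h1 := h.1 u hu
  have h2 := h.2 v hv
  simp only [gradNorm_rpow_mul_inner g u _ hp, gradNorm_rpow_mul_inner g v _ hq] at h1 h2
  have h3 : ∫ x, |u x| ^ α * |v x| ^ β * v x * u x ∂(riemannianVolume g) = 1 := by
    rw [← hB, coupling]
    exact integral_congr_ae (Eventually.of_forall fun x => by simp only; ring)
  have h4 : ∫ x, |u x| ^ α * |v x| ^ β * u x * v x ∂(riemannianVolume g) = 1 := hB
  rw [energy, h1, h2, h3, h4, mul_one, ← add_mul, hpq, one_mul]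

omit [BorelSpace M] in
theorem energy_nonneg (g : Metric m M) (u v : M → ℝ) (hp : 1 < p) (hq : 1 < q) (hα : 0 < α)
    (hβ : 0 < β) : 0 ≤ energy p q α β g u v := by
  have hnn : ∀ (w : M → ℝ) (r : ℝ), 0 ≤ ∫ x, gradNorm g w x ^ r ∂(riemannianVolume g) :=
    fun w r => integral_nonneg fun x => Real.rpow_nonneg (Real.sqrt_nonneg _) _
  exact add_nonneg (mul_nonneg (div_nonneg (by linarith) (by linarith)) (hnn u p))
    (mul_nonneg (div_nonneg (by linarith) (by linarith)) (hnn v q))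

omit [BorelSpace M] in
theorem firstEigenvalue_le {K : Competitors} {g : Metric m M} {u v : M → ℝ} (hp : 1 < p)
    (hq : 1 < q) (hα : 0 < α) (hβ : 0 < β) (h : Admissible K p q α β g u v) :
    firstEigenvalue K p q α β g ≤ energy p q α β g u v := by
  refine csInf_le ⟨0, ?_⟩ ⟨u, v, h, rfl⟩
  rintro _ ⟨u, v, -, rfl⟩
  exact energy_nonneg g u v hp hq hα hβ

/-! ### The normalized family -/

variable {D : Set ℝ} {g : ℝ → Metric m M} {t₁ : ℝ}

/-- The factor `[det g(t₁) / det g(t)]^{1 / (2(α+β+1))}`. -/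
def rescaling (α β : ℝ) (g : ℝ → Metric m M) (t₁ t : ℝ) (x : M) : ℝ :=
  detRatio g t₁ t x ^ (1 / (2 * (α + β + 1)))

omit [CompactSpace M] [MeasurableSpace M] [BorelSpace M] in
theorem rescaling_pos (t : ℝ) (x : M) : 0 < rescaling α β g t₁ t x :=
  Real.rpow_pos_of_pos (detRatio_pos ..) _

omit [CompactSpace M] [MeasurableSpace M] [BorelSpace M] in
theorem rescaling_self (x : M) : rescaling α β g t₁ t₁ x = 1 := by
  rw [rescaling, detRatio_self, Real.one_rpow]

omit [CompactSpace M] [MeasurableSpace M] [BorelSpace M] in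
theorem SmoothMetric.rescaling (hg : SmoothMetric D g) (ht₁ : t₁ ∈ D) (α β : ℝ) :
    SmoothFamily (m := m) D (rescaling α β g t₁) :=
  (hg.detRatio ht₁).rpow_const (fun t _ x => (detRatio_pos g t₁ t x).ne') _

omit [CompactSpace M] [MeasurableSpace M] [BorelSpace M] in
/-- The exponent of the rescaling is chosen so that `f^{α+β+1} dμ` does not depend on time. -/
theorem rescaling_mul_density (hα : 0 < α) (hβ : 0 < β) (t : ℝ) (x : M) :
    rescaling α β g t₁ t x ^ α * rescaling α β g t₁ t x ^ β * rescaling α β g t₁ t x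
      * density g t₁ t x = 1 := by
  have h0 := rescaling_pos (α := α) (β := β) (g := g) (t₁ := t₁) t x
  have hd := detRatio_pos g t₁ t x
  have h1 : rescaling α β g t₁ t x ^ α * rescaling α β g t₁ t x ^ β * rescaling α β g t₁ t x
      = Real.sqrt (detRatio g t₁ t x) := by
    nth_rewrite 3 [← Real.rpow_one (rescaling α β g t₁ t x)]
    rw [← Real.rpow_add h0, ← Real.rpow_add h0, rescaling, ← Real.rpow_mul hd.le,
      Real.sqrt_eq_rpow]
    congr 1
    have : α + β + 1 ≠ 0 := by positivity
    field_simp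
  have h2 : detRatio g t t₁ x = (detRatio g t₁ t x)⁻¹ := by
    rw [detRatio, detRatio, inv_div]
  rw [h1, density, h2, Real.sqrt_inv, mul_inv_cancel₀ (Real.sqrt_pos.2 hd).ne']

/-- The normalizing integral is smooth in time. -/
theorem SmoothMetric.contDiffOn_normalizer (hg : SmoothMetric D g) (hD : IsCompact D)
    (hconv : Convex ℝ D) (hU : UniqueDiffOn ℝ D) (ht₁ : t₁ ∈ D) {u v : M → ℝ}
    (hB : coupling α β (g t₁) u v = 1) :
    ContDiffOn ℝ ∞ (normalizer α β g t₁ u v) D := by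
  -- a nonzero Bochner integral has an integrable integrand
  have hW : Integrable (fun x => |u x| ^ α * |v x| ^ β * u x * v x) (riemannianVolume (g t₁)) := by
    by_contra h
    rw [coupling, integral_undef h] at hB
    exact zero_ne_one hB
  have hR := hg.rescaling ht₁ α β
  have hR0 : ∀ t ∈ D, ∀ x, RHFlow.rescaling α β g t₁ t x ≠ 0 := fun t _ x =>
    (rescaling_pos t x).ne'
  have hQ := ((((hR.rpow_const hR0 α).mul (hR.rpow_const hR0 β)).mul hR).mul hR).mul
    (hg.density ht₁)
  refine (hQ.contDiffOn_integral hD hconv hU hW).congr fun t ht => ?_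
  rw [normalizer, coupling, hg.integral_eq ht₁ ht]
  refine integral_congr_ae (Eventually.of_forall fun x => ?_)
  have h0 := (rescaling_pos (α := α) (β := β) (g := g) (t₁ := t₁) t x).le
  have hres : ∀ w : M → ℝ, rescaled α β g t₁ w t x = w x * RHFlow.rescaling α β g t₁ t x :=
    fun w => rfl
  simp only [hres, abs_mul, abs_of_nonneg h0, Real.mul_rpow (abs_nonneg _) h0]
  ring

omit [BorelSpace M] in
theorem normalizer_self {u v : M → ℝ} (hB : coupling α β (g t₁) u v = 1) :
    normalizer α β g t₁ u v t₁ = 1 := by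
  have hres : ∀ w : M → ℝ, rescaled α β g t₁ w t₁ = w := fun w => by
    funext x
    change w x * rescaling α β g t₁ t₁ x = w x
    rw [rescaling_self, mul_one]
  rw [normalizer, hres, hres, hB]

omit [BorelSpace M] in
/-- The family `u(t)` satisfies `B(u(t), v(t)) = 1`. -/
theorem coupling_family {u v : M → ℝ} (hpq : (α + 1) / p + (β + 1) / q = 1) {t : ℝ}
    (hN : 0 < normalizer α β g t₁ u v t) :
    coupling α β (g t) (familyU p α β g t₁ u v t) (familyV q α β g t₁ u v t) = 1 := by
  set c := normalizer α β g t₁ u v t with hc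
  have hcp : 0 < c ^ (1 / p) := Real.rpow_pos_of_pos hN _
  have hcq : 0 < c ^ (1 / q) := Real.rpow_pos_of_pos hN _
  have h1 : coupling α β (g t) (familyU p α β g t₁ u v t) (familyV q α β g t₁ u v t)
      = c * ((c ^ (1 / p)) ^ α * (c ^ (1 / q)) ^ β * c ^ (1 / p) * c ^ (1 / q))⁻¹ := by
    have h0 : c = ∫ x, |rescaled α β g t₁ u t x| ^ α * |rescaled α β g t₁ v t x| ^ β
        * rescaled α β g t₁ u t x * rescaled α β g t₁ v t x ∂(riemannianVolume (g t)) := rfl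
    refine Eq.trans ?_ ((integral_mul_const _ _).trans (congrArg (· * _) h0.symm))
    refine integral_congr_ae (Eventually.of_forall fun x => ?_)
    simp only [familyU, familyV, ← hc, abs_div, abs_of_pos hcp, abs_of_pos hcq,
      Real.div_rpow (abs_nonneg _) hcp.le, Real.div_rpow (abs_nonneg _) hcq.le]
    simp only [div_eq_mul_inv, mul_inv]
    ring
  have h2 : (c ^ (1 / p)) ^ α * (c ^ (1 / q)) ^ β * c ^ (1 / p) * c ^ (1 / q) = c := by
    rw [← Real.rpow_mul hN.le, ← Real.rpow_mul hN.le, ← Real.rpow_add hN, ← Real.rpow_add hN,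
      ← Real.rpow_add hN]
    conv_rhs => rw [← Real.rpow_one c, ← hpq]
    congr 1
    ring
  rw [h1, h2, mul_inv_cancel₀ hN.ne']

/-- The balancing conditions are preserved along the family. -/
theorem SmoothMetric.condition_family (hg : SmoothMetric D g) {K : Competitors} {u v : M → ℝ}
    (hα : 0 < α) (hβ : 0 < β) {t : ℝ} (ht₁ : t₁ ∈ D) (ht : t ∈ D)
    (hN : 0 < normalizer α β g t₁ u v t) (h : K.Condition α β (g t₁) u v) :
    K.Condition α β (g t) (familyU p α β g t₁ u v t) (familyV q α β g t₁ u v t) := by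
  cases K with
  | normalized => trivial
  | balanced =>
    set c := normalizer α β g t₁ u v t with hc
    have hcp : 0 < c ^ (1 / p) := Real.rpow_pos_of_pos hN _
    have hcq : 0 < c ^ (1 / q) := Real.rpow_pos_of_pos hN _
    have hpow : ∀ (w : M → ℝ) (x : M) (r e : ℝ), 0 < r →
        |rescaled α β g t₁ w t x / r| ^ e
          = |w x| ^ e * RHFlow.rescaling α β g t₁ t x ^ e / r ^ e := by
      intro w x r e hr
      have h0 := (rescaling_pos (α := α) (β := β) (g := g) (t₁ := t₁) t x).le
      have hres : rescaled α β g t₁ w t x = w x * RHFlow.rescaling α β g t₁ t x := rfl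
      rw [hres, abs_div, abs_of_pos hr, Real.div_rpow (abs_nonneg _) hr.le, abs_mul,
        abs_of_nonneg h0, Real.mul_rpow (abs_nonneg _) h0]
    have hone := fun x => rescaling_mul_density (g := g) (t₁ := t₁) hα hβ t x
    -- the integrals at time `t` are multiples of the integrals at time `t₁`
    have key : ∀ (w : M → ℝ) (r : ℝ), ∫ x, |rescaled α β g t₁ u t x / c ^ (1 / p)| ^ α
          * |rescaled α β g t₁ v t x / c ^ (1 / q)| ^ β * (rescaled α β g t₁ w t x / r)
          ∂(riemannianVolume (g t))
        = (∫ x, |u x| ^ α * |v x| ^ β * w x ∂(riemannianVolume (g t₁)))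
          * ((c ^ (1 / p)) ^ α * (c ^ (1 / q)) ^ β * r)⁻¹ := by
      intro w r
      rw [hg.integral_eq ht₁ ht, ← integral_mul_const]
      refine integral_congr_ae (Eventually.of_forall fun x => ?_)
      have hres : rescaled α β g t₁ w t x = w x * RHFlow.rescaling α β g t₁ t x := rfl
      simp only [hpow _ _ _ _ hcp, hpow _ _ _ _ hcq]
      rw [hres]
      calc _ = (|u x| ^ α * |v x| ^ β * w x) * ((c ^ (1 / p)) ^ α * (c ^ (1 / q)) ^ β * r)⁻¹
            * (RHFlow.rescaling α β g t₁ t x ^ α * RHFlow.rescaling α β g t₁ t x ^ β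
              * RHFlow.rescaling α β g t₁ t x * RHFlow.density g t₁ t x) := by
            simp only [div_eq_mul_inv, mul_inv]
            ring
        _ = _ := by rw [hone, mul_one]
    exact ⟨(key v _).trans (by rw [h.1, zero_mul]), (key u _).trans (by rw [h.2, zero_mul])⟩

end Eigenvalue

theorem exists_Icc_subset_timeDomain {T : EReal} {t₁ : ℝ} (ht₁ : t₁ ∈ timeDomain T) :
    ∃ b, t₁ < b ∧ Icc 0 b ⊆ timeDomain T := by
  obtain ⟨b, hb1, hb2⟩ := EReal.lt_iff_exists_real_btwn.1 ht₁.2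
  refine ⟨b, EReal.coe_lt_coe_iff.1 hb1, fun t ht => ⟨ht.1, ?_⟩⟩
  exact (EReal.coe_le_coe_iff.2 ht.2).trans_lt hb2

/-- A bounded derivative is integrable: it is measurable in the interior. -/
theorem intervalIntegrable_of_hasDerivWithinAt {f f' : ℝ → ℝ} {a b C : ℝ} (hab : a ≤ b)
    (h : ∀ t ∈ Icc a b, HasDerivWithinAt f (f' t) (Icc a b) t) (hC : ∀ t ∈ Icc a b, |f' t| ≤ C) :
    IntervalIntegrable f' volume a b := by
  rw [intervalIntegrable_iff_integrableOn_Ioo_of_le hab]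
  have hd : EqOn (deriv f) f' (Ioo a b) := fun t ht =>
    ((h t (Ioo_subset_Icc_self ht)).hasDerivAt (Icc_mem_nhds ht.1 ht.2)).deriv
  have h1 : IntegrableOn (deriv f) (Ioo a b) volume :=
    Measure.integrableOn_of_bounded (M := C) (by simp) (measurable_deriv f).aestronglyMeasurable
      ((ae_restrict_iff' measurableSet_Ioo).2 (Eventually.of_forall fun t ht => by
        rw [hd ht, Real.norm_eq_abs]
        exact hC t (Ioo_subset_Icc_self ht)))
  exact h1.congr_fun hd measurableSet_Ioo

end RHFlow

end

open RHFlow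
theorem proposition3p2
    -- the closed manifold `M` and the closed target `(N, γ)`
    {m n : ℕ}
    {M : Type*} [TopologicalSpace M] [ChartedSpace (Euc m) M] [IsManifold (𝓡 m) ∞ M]
    [CompactSpace M] [T2Space M] [MeasurableSpace M] [BorelSpace M]
    {N : Type*} [TopologicalSpace N] [ChartedSpace (Euc n) N] [IsManifold (𝓡 n) ∞ N]
    [CompactSpace N] [T2Space N]
    (γ : Metric n N)
    -- the flow, with coupling constant `κ`
    (κ : ℝ) (hκ : 0 ≤ κ) (T : EReal) (g : ℝ → Metric m M) (φ : ℝ → M → N)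
    (hflow : IsRHFlow γ κ T g φ)
    -- the exponents of the eigenvalue problem
    (p q α β : ℝ) (hp : 1 < p) (hq : 1 < q) (hα : 0 < α) (hβ : 0 < β)
    (hpq : (α + 1) / p + (β + 1) / q = 1)
    -- the class of competitors which defines the first eigenvalue
    (K : Competitors)
    (t₀ t₁ : ℝ) (ht₀ : t₀ ∈ timeDomain T) (ht₁ : t₁ ∈ timeDomain T) (h01 : t₀ < t₁)
    -- eigenfunctions at time `t₁`, whose rescalings can be normalized on `[t₀, t₁]`
    (u₁ v₁ : M → ℝ) (heig : IsFirstEigenpair K p q α β (g t₁) u₁ v₁)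
    (hpos : ∀ τ ∈ Set.Icc t₀ t₁, 0 < normalizer α β g t₁ u₁ v₁ τ) :
    let u : ℝ → M → ℝ := familyU p α β g t₁ u₁ v₁
    let v : ℝ → M → ℝ := familyV q α β g t₁ u₁ v₁
    let u' : ℝ → M → ℝ := timeDeriv T u
    let v' : ℝ → M → ℝ := timeDeriv T v
    let rate : ℝ → ℝ := fun τ => energyRate p q α β γ κ (g τ) (φ τ) (u τ) (u' τ) (v τ) (v' τ)
    -- the family is normalized, regular, and passes through the eigenfunctions at time `t₁`
    (∀ τ ∈ Set.Icc t₀ t₁, Admissible K p q α β (g τ) (u τ) (v τ)) ∧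
    (∀ τ ∈ Set.Icc t₀ t₁, ∀ x : M,
      ContDiffWithinAt ℝ ∞ (fun s => u s x) (timeDomain T) τ ∧
      ContDiffWithinAt ℝ ∞ (fun s => v s x) (timeDomain T) τ) ∧
    (∀ τ ∈ Set.Icc t₀ t₁, MemW (g τ) p (u' τ) ∧ MemW (g τ) q (v' τ)) ∧
    u t₁ = u₁ ∧ v t₁ = v₁ ∧
    energy p q α β (g t₁) (u t₁) (v t₁) = firstEigenvalue K p q α β (g t₁) ∧
    -- `𝒢` is the time derivative of the energy, and it is integrable
    (∀ τ ∈ Set.Icc t₀ t₁,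
      HasDerivWithinAt (fun s => energy p q α β (g s) (u s) (v s)) (rate τ) (Set.Icc t₀ t₁) τ) ∧
    IntervalIntegrable rate volume t₀ t₁ ∧
    -- the inequality
    firstEigenvalue K p q α β (g t₁)
      ≥ firstEigenvalue K p q α β (g t₀) + ∫ τ in t₀..t₁, rate τ := by
  intro u v u' v' rate
  obtain ⟨⟨hu₁, hv₁, hB, hcond⟩, heig⟩ := heig
  obtain ⟨b, hb, hbT⟩ := exists_Icc_subset_timeDomain ht₁
  -- the larger interval is a neighbourhood of `[t₀, t₁]` within `[0, T)`
  set D₁ : Set ℝ := Set.Icc 0 b with hD₁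
  set D : Set ℝ := Set.Icc t₀ t₁ with hD
  have hDD : D ⊆ D₁ := Set.Icc_subset_Icc ht₀.1 hb.le
  have hD₁n : ∀ τ ∈ D, D₁ ∈ nhdsWithin τ (timeDomain T) := fun τ hτ => by
    filter_upwards [self_mem_nhdsWithin, mem_nhdsWithin_of_mem_nhds
      (Iio_mem_nhds (hτ.2.trans_lt hb))] with s hs hsb
    exact ⟨hs.1, (Set.mem_Iio.1 hsb).le⟩
  have h0b : 0 < b := (ht₁.1).trans_lt hb
  have hg₁ : SmoothMetric D₁ g := hflow.smoothMetric hbT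
  have hg : SmoothMetric D g := hg₁.mono hDD
  have hS := hflow.evolvesBy (hDD.trans hbT)
  have ht₁D : t₁ ∈ D := Set.right_mem_Icc.2 h01.le
  have ht₀D : t₀ ∈ D := Set.left_mem_Icc.2 h01.le
  have hU : UniqueDiffOn ℝ D := uniqueDiffOn_Icc h01
  have hcl : D ⊆ closure (interior D) := by
    rw [hD, interior_Icc, closure_Ioo h01.ne]
  have hDc : IsCompact D := isCompact_Icc
  have hconv : Convex ℝ D := convex_Icc _ _
  have hN := hg₁.contDiffOn_normalizer (α := α) (β := β) isCompact_Icc (convex_Icc _ _)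
    (uniqueDiffOn_Icc h0b) (hDD ht₁D) hB
  -- both components are multiples of the eigenfunctions by smooth families
  let a : ℝ → ℝ → M → ℝ := fun r t x =>
    rescaling α β g t₁ t x * (normalizer α β g t₁ u₁ v₁ t ^ (1 / r))⁻¹
  have ha : ∀ r, SmoothFamily (m := m) D (a r) := fun r =>
    (hg.rescaling ht₁D α β).mul (SmoothFamily.of_time
      (((hN.mono hDD).rpow_const_of_ne fun t ht => (hpos t ht).ne').inv fun t ht =>
        (Real.rpow_pos_of_pos (hpos t ht) _).ne'))
  have hu : ∀ t, u t = fun x => a p t x * u₁ x := fun t => by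
    funext x
    simp only [u, familyU, rescaled, a, rescaling, detRatio, div_eq_mul_inv]
    ring
  have hv : ∀ t, v t = fun x => a q t x * v₁ x := fun t => by
    funext x
    simp only [v, familyV, rescaled, a, rescaling, detRatio, div_eq_mul_inv]
    ring
  have hreg : ∀ r, ∀ w : M → ℝ, ∀ τ ∈ D, ∀ x,
      ContDiffWithinAt ℝ ∞ (fun s => a r s x * w x) (timeDomain T) τ := fun r w τ hτ x => by
    refine ContDiffWithinAt.mono_of_mem_nhdsWithin (s := D₁) ?_ (hD₁n τ hτ)
    refine ContDiffWithinAt.mul ?_ contDiffWithinAt_const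
    refine ((hg₁.rescaling (hDD ht₁D) α β).contDiffOn_time x τ (hDD hτ)).mul ?_
    exact ((hN τ (hDD hτ)).rpow_const_of_ne (hpos τ hτ).ne').inv
      (Real.rpow_pos_of_pos (hpos τ hτ) _).ne'
  have hderiv : ∀ r, ∀ w : M → ℝ, ∀ τ ∈ D,
      timeDeriv T (fun s x => a r s x * w x) τ = fun x => timeD D (a r) τ x * w x := by
    intro r w τ hτ
    funext x
    have h1 := (((hreg r w τ hτ x).differentiableWithinAt (by simp)).hasDerivWithinAt).mono
      (hDD.trans hbT)
    exact (hU τ hτ).eq_deriv _ h1 (((ha r).hasDerivWithinAt hτ x).mul_const (w x))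
  have hueq : u = fun t x => a p t x * u₁ x := funext hu
  have hveq : v = fun t x => a q t x * v₁ x := funext hv
  have hu' : ∀ τ ∈ D, u' τ = fun x => timeD D (a p) τ x * u₁ x := fun τ hτ => by
    rw [← hderiv p u₁ τ hτ, ← hueq]
  have hv' : ∀ τ ∈ D, v' τ = fun x => timeD D (a q) τ x * v₁ x := fun τ hτ => by
    rw [← hderiv q v₁ τ hτ, ← hveq]
  have hadm : ∀ τ ∈ D, Admissible K p q α β (g τ) (u τ) (v τ) := fun τ hτ => by
    refine ⟨?_, ?_, coupling_family hpq (hpos τ hτ),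
      hg.condition_family hα hβ ht₁D hτ (hpos τ hτ) hcond⟩
    · rw [hu]
      exact hg.memW_mul hDc hU (ha p) ht₁D hτ hu₁
    · rw [hv]
      exact hg.memW_mul hDc hU (ha q) ht₁D hτ hv₁
  have ha1 : ∀ r x, a r t₁ x = 1 := fun r x => by
    simp only [a, rescaling_self, normalizer_self hB, Real.one_rpow, inv_one, mul_one]
  have hut₁ : u t₁ = u₁ := by
    rw [hu]
    funext x
    rw [ha1, one_mul]
  have hvt₁ : v t₁ = v₁ := by
    rw [hv]
    funext x
    rw [ha1, one_mul]
  have hE₁ : energy p q α β (g t₁) (u t₁) (v t₁) = firstEigenvalue K p q α β (g t₁) := by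
    rw [hut₁, hvt₁]
    rcases heig with h | h
    · exact h.energy_eq hp hq hpq hu₁ hv₁ hB
    · exact h
  obtain ⟨C, hCu⟩ := hS.hasDerivWithinAt_dirichlet hg hDc hconv hU hcl (ha p) ht₁D hp hu₁
    (fun t _ => hu t) hu'
  obtain ⟨C', hCv⟩ := hS.hasDerivWithinAt_dirichlet hg hDc hconv hU hcl (ha q) ht₁D hq hv₁
    (fun t _ => hv t) hv'
  simp only [metricTrace_tensorS] at hCu hCv
  have hp0 : p ≠ 0 := by linarith
  have hq0 : q ≠ 0 := by linarith
  have hrate : ∀ (c r A B : ℝ), r ≠ 0 → c / r * (r * A - B) = c * A - c / r * B := by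
    intro c r A B hr
    field_simp
  have hder : ∀ τ ∈ D,
      HasDerivWithinAt (fun s => energy p q α β (g s) (u s) (v s)) (rate τ) D τ := fun τ hτ => by
    refine (((hCu τ hτ).1.const_mul ((α + 1) / p)).add
      ((hCv τ hτ).1.const_mul ((β + 1) / q))).congr_deriv ?_
    rw [hrate _ _ _ _ hp0, hrate _ _ _ _ hq0]
    simp only [rate, energyRate]
    ring
  have hbd : ∀ τ ∈ D, |rate τ| ≤ |(α + 1) / p| * C + |(β + 1) / q| * C' := fun τ hτ => by
    have h1 := (hU τ hτ).eq_deriv _ (hder τ hτ)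
      (((hCu τ hτ).1.const_mul ((α + 1) / p)).add ((hCv τ hτ).1.const_mul ((β + 1) / q)))
    rw [h1]
    refine (abs_add_le _ _).trans (add_le_add ?_ ?_)
    · rw [abs_mul]
      exact mul_le_mul_of_nonneg_left (hCu τ hτ).2 (abs_nonneg _)
    · rw [abs_mul]
      exact mul_le_mul_of_nonneg_left (hCv τ hτ).2 (abs_nonneg _)
  have hint : IntervalIntegrable rate volume t₀ t₁ :=
    intervalIntegrable_of_hasDerivWithinAt h01.le hder hbd
  refine ⟨hadm, fun τ hτ x => ⟨?_, ?_⟩, fun τ hτ => ⟨?_, ?_⟩, hut₁, hvt₁, hE₁, hder, hint, ?_⟩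
  · simp only [hu]
    exact hreg p u₁ τ hτ x
  · simp only [hv]
    exact hreg q v₁ τ hτ x
  · rw [hu' τ hτ]
    exact hg.memW_mul hDc hU ((ha p).time_deriv hU) ht₁D hτ hu₁
  · rw [hv' τ hτ]
    exact hg.memW_mul hDc hU ((ha q).time_deriv hU) ht₁D hτ hv₁
  · have hftc := intervalIntegral.integral_eq_sub_of_hasDerivAt_of_le h01.le
      (fun τ hτ => (hder τ hτ).continuousWithinAt)
      (fun τ hτ => (hder τ (Set.Ioo_subset_Icc_self hτ)).hasDerivAt (Icc_mem_nhds hτ.1 hτ.2)) hint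
    have hle := firstEigenvalue_le hp hq hα hβ (hadm t₀ ht₀D)
    rw [hftc, hE₁]
    linarith
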